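/- For $n \ge 0$ and $x,y\in[0,n\log 2]$ let $$f_{\mathbb{Z}_{2^n}}(x,y)=\min\{H(X+Y)\;:\;X,Y \text{ independent } \mathbb{Z}_{2^n}\text{-valued random variables with } H(X)=x,\ H(Y)=y\},$$ where $H(X)=-\sum_{g}P(X=g)\log P(X=g)$ denotes Shannon entropy (natural logarithm, $0\log 0=0$) and $+$ is addition in the cyclic group $\mathbb{Z}_{2^n}$ of order $2^n$. Let $h(p)=-p\log p-(1-p)\log(1-p)$ be the binary entropy function on $[0,1]$, let $h^{-1}:[0,\log 2]\to[0,\tfrac12]$ be the inverse of its restriction to $[0,\tfrac12]$, let $a\star b=a(1-b)+(1-a)b$, and let $$f_2(x,y)=h\bigl(h^{-1}(x)\star h^{-1}(y)\bigr),\qquad x,y\in[0,\log 2].$$ **Theorem 4.1.** For all integers $n\ge 0$ and all $x,y\in[0,n\log 2]$, the minimum defining $f_{\mathbb{Z}_{2^n}}(x,y)$ is attained, and $$f_{\mathbb{Z}_{2^n}}(x,y)=\begin{cases} f_2(x-k\log 2,\;y-k\log 2)+k\log 2, & \text{if } k\log 2\le x,y\le (k+1)\log 2 \text{ for some integer } k\ge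 0,\\ \max(x,y), & \text{otherwise.}\end{cases}$$ (If several $k$ qualify, the formula holds for each of them.) -/

import Mathlib

open MeasureTheory ProbabilityTheory Set

/-- Shannon entropy (in nats) of a random variable `X` with values in a finite set `G`:
`H(X) = -∑ g, P(X = g) log P(X = g)`, with `0 log 0 = 0`. -/
noncomputable def shannonEntropy {Ω G : Type*} [MeasurableSpace Ω] [Fintype G]
    (μ : Measure Ω) (X : Ω → G) : ℝ :=
  ∑ g, Real.negMulLog (μ.real (X ⁻¹' {g}))

universe u

/-- The set of all values `H(X + Y)`, where `X` and `Y` are independent random variables on a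
common probability space, with values in the finite group `G` (with all
subsets measurable), such that `H(X) = x` and `H(Y) = y`. -/
def sumEntropies (G : Type*) [AddCommGroup G] [Fintype G]
    [MeasurableSpace G] [MeasurableSingletonClass G] (x y : ℝ) : Set ℝ :=
  {z | ∃ (Ω : Type u) (_ : MeasurableSpace Ω) (μ : Measure Ω) (X Y : Ω → G),
    IsProbabilityMeasure μ ∧ Measurable X ∧ Measurable Y ∧
    IndepFun X Y μ ∧
    shannonEntropy μ X = x ∧ shannonEntropy μ Y = y ∧
    shannonEntropy μ (fun ω => X ω + Y ω) = z}

/-- The function `f_G(x, y) = min {H(X + Y) | H(X) = x, H(Y) = y}`, written as an infimum. -/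
noncomputable def minSumEntropy (G : Type*) [AddCommGroup G] [Fintype G]
    [MeasurableSpace G] [MeasurableSingletonClass G] (x y : ℝ) : ℝ :=
  sInf (sumEntropies.{u} G x y)

/-- The inverse `h⁻¹ : [0, log 2] → [0, 1/2]` of the binary entropy function `h` restricted to
`[0, 1/2]` (with an irrelevant value outside `[0, log 2]`). -/
noncomputable def binEntropyInv : ℝ → ℝ :=
  Function.invFunOn Real.binEntropy (Icc 0 2⁻¹)

/-- The binary convolution `a ⋆ b = a (1 - b) + (1 - a) b`. -/
def binConv (a b : ℝ) : ℝ := a * (1 - b) + (1 - a) * b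

/-- The function `f₂(x, y) = h(h⁻¹(x) ⋆ h⁻¹(y))` on `[0, log 2] × [0, log 2]`. -/
noncomputable def f₂ (x y : ℝ) : ℝ :=
  Real.binEntropy (binConv (binEntropyInv x) (binEntropyInv y))

theorem exists_binEntropy_eq {t : ℝ} (ht : t ∈ Icc 0 (Real.log 2)) :
    ∃ p ∈ Icc (0 : ℝ) 2⁻¹, Real.binEntropy p = t := by
  have h := intermediate_value_Icc (a := (0 : ℝ)) (b := 2⁻¹) (by norm_num)
    Real.binEntropy_continuous.continuousOn
  rw [Real.binEntropy_zero, Real.binEntropy_two_inv] at h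
  exact h ht

theorem binEntropyInv_mem {t : ℝ} (ht : t ∈ Icc 0 (Real.log 2)) :
    binEntropyInv t ∈ Icc (0 : ℝ) 2⁻¹ :=
  Function.invFunOn_mem (exists_binEntropy_eq ht)

theorem binEntropy_binEntropyInv {t : ℝ} (ht : t ∈ Icc 0 (Real.log 2)) :
    Real.binEntropy (binEntropyInv t) = t :=
  Function.invFunOn_eq (exists_binEntropy_eq ht)

theorem binEntropyInv_binEntropy {p : ℝ} (hp : p ∈ Icc (0 : ℝ) 2⁻¹) :
    binEntropyInv (Real.binEntropy p) = p :=
  Real.binEntropy_strictMonoOn.injOn.leftInvOn_invFunOn hp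

/-!
# Minimal entropy of sums in the cyclic groups of order `2 ^ n`

Write `L = log 2`, let `biasEntropy u` be the entropy of a bit with probabilities `(1 ± u) / 2`, and
let `bias` be its inverse on `[0, 1]`. Biases multiply under addition of independent bits, so
`f₂ x y = biasEntropy (bias x * bias y)` (`f₂_eq`).

**Reduction to an inequality for `f₂`.** The projection from `ZMod (2 ^ (n + 1))` to `ZMod (2 ^ n)`
has kernel `{0, τ}`. Splitting an entropy into the entropy of the projection and the average entropy
on the fibres, and using concavity of `biasEntropy` and the convexity of `f₂` in each variable
(Mrs. Gerber's lemma, `convexOn_f₂_left`), one finds that if `X` and `Y` have projected entropies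
`u, v` and fibre entropies `a, b`, then `H(X + Y)` is at least the minimum for `(u, v)` in
`ZMod (2 ^ n)` plus `f₂ a b` (`IsDoubleCover.weightEntropy_addConv_ge`). By induction, the lower
bound follows once the claimed minimum `F` satisfies `F (u + a) (v + b) ≤ F u v + f₂ a b`
(`IsAboveMin.add`). When `(u, v)` and `(u + a, v + b)` lie in the same diagonal block
`[k L, (k + 1) L]²` this is subadditivity of `f₂` (`f₂_add_le`), when they lie in consecutive ones
it is superadditivity of the reflection `(x, y) ↦ L - f₂ (L - x) (L - y)` (`f₂Refl_add_ge`), and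
otherwise `f₂` being monotone and `1`-Lipschitz suffices.

**Both inequalities** come from the behaviour of the partial derivative
`∂₁ f₂ = v * artanh (u * v) / artanh u`, where `u = bias x` and `v = bias y`, along rays. It
decreases along rays from the origin (`antitoneOn_f₂Slope_ray`). As it also increases in `x` and
decreases in `y`, in the defect of subadditivity at two points the coordinate of one of them can be
decreased, without increasing the defect, until the points are collinear with the origin, and there
subadditivity is concavity along the ray. The reflection is treated alike with
`monotoneOn_f₂Slope_ray`, where monotonicity holds only on one side of the diagonal; which
coordinate is decreased depends on the side on which the sum of the two points lies.

**Monotonicity along rays** is, in terms of `u` and `v` and of the elasticity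
`ℓ u = u / ((1 - u ^ 2) * artanh u)` of `artanh`, the inequality
`(r u + r v) * (1 + ℓ (u * v)) ≥ r u * (1 + ℓ u)`, with `r u = biasEntropy u / (u * artanh u)` for
the first kind of rays and, for `u ≤ v`, with `r u = (L - biasEntropy u) / (u * artanh u)` for the
second (`elasticity_ineq_biasEntropy`, `elasticity_ineq_log_two_sub_biasEntropy`). Both reduce to
monotonicity of functions of one variable. The delicate one is that `(1 + ℓ) * biasEntropy` is
antitone; in the variable `θ = artanh u` it follows from an inequality between hyperbolic functions
whose power series has nonnegative coefficients (`hyperbolic_combination_nonneg`).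

**The bound is attained** by a bit with values in `{0, τ}` for entropies at most `L`, and by
spreading a minimizer for `ZMod (2 ^ n)` uniformly over the fibres for entropies at least `L`; if
one entropy is of each kind, adding the bit leaves the spread-out distribution unchanged.
-/

/-! ### The inverse hyperbolic tangent -/

theorem hasDerivAt_artanh {u : ℝ} (hu : u ∈ Ioo (-1 : ℝ) 1) :
    HasDerivAt Real.artanh (1 / (1 - u ^ 2)) u := by
  have h1 : 0 < 1 + u := by linarith [hu.1]
  have h2 : 0 < 1 - u := by linarith [hu.2]
  have h3 : (1 - u ^ 2) ≠ 0 := by nlinarith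
  have h : HasDerivAt (fun x : ℝ => 1 / 2 * (Real.log (1 + x) - Real.log (1 - x)))
      (1 / (1 - u ^ 2)) u := by
    have ha : HasDerivAt (fun x : ℝ => Real.log (1 + x)) (1 / (1 + u)) u :=
      ((hasDerivAt_id u).const_add 1).log h1.ne'
    have hb : HasDerivAt (fun x : ℝ => Real.log (1 - x)) (-1 / (1 - u)) u :=
      ((hasDerivAt_id u).const_sub 1).log h2.ne'
    refine ((ha.sub hb).const_mul (1 / 2 : ℝ)).congr_deriv ?_
    field_simp
    ring
  refine h.congr_of_eventuallyEq ?_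
  filter_upwards [Ioo_mem_nhds hu.1 hu.2] with x hx
  rw [Real.artanh_eq_half_log (Ioo_subset_Icc_self hx),
    Real.log_div (by linarith [hx.1]) (by linarith [hx.2])]

theorem le_artanh {u : ℝ} (hu : u ∈ Ico (0 : ℝ) 1) : u ≤ Real.artanh u := by
  have h : MonotoneOn (fun x => Real.artanh x - x) (Ico 0 1) := by
    refine monotoneOn_of_hasDerivWithinAt_nonneg (f' := fun x => 1 / (1 - x ^ 2) - 1)
      (convex_Ico 0 1) ?_ ?_ ?_
    · intro x hx
      exact ((hasDerivAt_artanh ⟨by linarith [hx.1], hx.2⟩).continuousAt.sub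
        continuousAt_id).continuousWithinAt
    · intro x hx
      rw [interior_Ico] at hx
      exact ((hasDerivAt_artanh ⟨by linarith [hx.1], hx.2⟩).sub (hasDerivAt_id x)).hasDerivWithinAt
    · intro x hx
      rw [interior_Ico] at hx
      have : 0 < 1 - x ^ 2 := by nlinarith [hx.1, hx.2]
      rw [sub_nonneg, le_div_iff₀ this]
      nlinarith
  have := h (left_mem_Ico.2 one_pos) hu hu.1
  simp at this
  linarith

theorem artanh_le_div {u : ℝ} (hu : u ∈ Ico (0 : ℝ) 1) : Real.artanh u ≤ u / (1 - u ^ 2) := by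
  have hpos : ∀ x ∈ Ico (0 : ℝ) 1, 0 < 1 - x ^ 2 := fun x hx => by nlinarith [hx.1, hx.2]
  have hd : ∀ x ∈ Ico (0 : ℝ) 1, HasDerivAt (fun x => x / (1 - x ^ 2) - Real.artanh x)
      (2 * x ^ 2 / (1 - x ^ 2) ^ 2) x := by
    intro x hx
    have h0 := (hpos x hx).ne'
    have h := ((hasDerivAt_id x).div (((hasDerivAt_id x).pow 2).const_sub 1) h0).sub
      (hasDerivAt_artanh ⟨by linarith [hx.1], hx.2⟩)
    refine h.congr_deriv ?_
    simp only [id, Pi.pow_apply]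
    field_simp
    push_cast
    ring
  have h : MonotoneOn (fun x => x / (1 - x ^ 2) - Real.artanh x) (Ico 0 1) := by
    refine monotoneOn_of_hasDerivWithinAt_nonneg (f' := fun x => 2 * x ^ 2 / (1 - x ^ 2) ^ 2)
      (convex_Ico 0 1) (fun x hx => (hd x hx).continuousAt.continuousWithinAt) ?_ ?_
    · intro x hx
      exact (hd x (interior_subset hx)).hasDerivWithinAt
    · intro x hx
      positivity
  have := h (left_mem_Ico.2 one_pos) hu hu.1
  simp at this
  linarith

/-! ### An inequality between hyperbolic functions -/

section Series

open Nat

theorem hasSum_mul_sinh (t : ℝ) :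
    HasSum (fun n : ℕ => (2 * n : ℝ) * (t ^ (2 * n) / (2 * n)!)) (t * Real.sinh t) := by
  rw [← hasSum_nat_add_iff' 1]
  convert (Real.hasSum_sinh t).mul_left t using 1
  · rfl
  · ext n
    rw [show 2 * (n + 1) = (2 * n + 1) + 1 by ring, Nat.factorial_succ]
    push_cast
    field_simp
    ring
  · simp

theorem hasSum_sq_mul_cosh (t : ℝ) :
    HasSum (fun n : ℕ => (2 * n * (2 * n - 1) : ℝ) * (t ^ (2 * n) / (2 * n)!))
      (t ^ 2 * Real.cosh t) := by
  rw [← hasSum_nat_add_iff' 1]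
  convert (Real.hasSum_cosh t).mul_left (t ^ 2) using 1
  · rfl
  · ext n
    rw [show 2 * (n + 1) = (2 * n + 1) + 1 by ring, Nat.factorial_succ, Nat.factorial_succ]
    push_cast
    field_simp
    ring
  · simp

theorem hasSum_cube_mul_sinh (t : ℝ) :
    HasSum (fun n : ℕ => (2 * n * (2 * n - 1) * (2 * n - 2) : ℝ) * (t ^ (2 * n) / (2 * n)!))
      (t ^ 3 * Real.sinh t) := by
  rw [← hasSum_nat_add_iff' 1]
  convert (hasSum_mul_sinh t).mul_left (t ^ 2) using 1
  · rfl
  · ext n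
    rw [show 2 * (n + 1) = (2 * n + 1) + 1 by ring, Nat.factorial_succ, Nat.factorial_succ]
    push_cast
    field_simp
    ring
  · simp; ring

/-- `(2 * m)!` times the coefficient of `θ ^ (2 * m)` in `432` times the combination of
`hyperbolic_combination_nonneg`. It vanishes for `m = 0, 1, 2`. -/
theorem hyperbolic_combination_coeff_nonneg (m : ℕ) :
    (0 : ℝ) ≤ 9 ^ m * (32 * (2 * m * (2 * m - 1) * (2 * m - 2)) - 120 * (2 * m * (2 * m - 1))
      + 144 * (2 * m) + 27) + 27 * 25 ^ m - 1080 * (2 * m * (2 * m - 1)) + 432 * (2 * m) - 54 := by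
  rcases Nat.lt_or_ge m 3 with h | h
  · interval_cases m <;> norm_num
  · have h3 : (3 : ℝ) ≤ m := by exact_mod_cast h
    have h9 : (729 : ℝ) ≤ 9 ^ m := by
      calc (729 : ℝ) = 9 ^ 3 := by norm_num
        _ ≤ 9 ^ m := pow_le_pow_right₀ (by norm_num) h
    have h25 : (1 : ℝ) ≤ 25 ^ m := one_le_pow₀ (by norm_num)
    have hm : (0 : ℝ) ≤ m * (2 * m - 1) := by nlinarith
    have hB : 16 * (m * (2 * m - 1) : ℝ) ≤ 32 * (2 * m * (2 * m - 1) * (2 * m - 2))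
        - 120 * (2 * m * (2 * m - 1)) + 144 * (2 * m) + 27 := by
      nlinarith [mul_nonneg hm (sub_nonneg.2 h3)]
    have := mul_le_mul h9 hB (by positivity) (by positivity)
    nlinarith

theorem hyperbolic_combination_nonneg (θ : ℝ) :
    0 ≤ 2 * θ ^ 3 * Real.sinh (3 * θ) - 5 / 2 * θ ^ 2 * (Real.cosh (3 * θ) + Real.cosh θ)
      + θ * (Real.sinh (3 * θ) + Real.sinh θ)
      + (Real.cosh (5 * θ) + Real.cosh (3 * θ) - 2 * Real.cosh θ) / 16 := by
  have hs := (((((((hasSum_cube_mul_sinh (3 * θ)).mul_left 32).sub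
    ((hasSum_sq_mul_cosh (3 * θ)).mul_left 120)).add
    ((hasSum_mul_sinh (3 * θ)).mul_left 144)).add
    ((Real.hasSum_cosh (3 * θ)).mul_left 27)).add
    ((Real.hasSum_cosh (5 * θ)).mul_left 27)).sub
    ((hasSum_sq_mul_cosh θ).mul_left 1080)).add
    (((hasSum_mul_sinh θ).mul_left 432).sub ((Real.hasSum_cosh θ).mul_left 54))
  have h := hs.nonneg (fun m => by
    have h3 : (3 * θ) ^ (2 * m) = 9 ^ m * θ ^ (2 * m) := by
      rw [mul_pow, pow_mul 3]; norm_num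
    have h5 : (5 * θ) ^ (2 * m) = 25 ^ m * θ ^ (2 * m) := by
      rw [mul_pow, pow_mul 5]; norm_num
    rw [h3, h5]
    have hθ : 0 ≤ θ ^ (2 * m) / ((2 * m)! : ℝ) := by
      rw [pow_mul]; positivity
    refine (mul_nonneg (hyperbolic_combination_coeff_nonneg m) hθ).trans_eq ?_
    ring)
  nlinarith

end Series

/-- `hyperbolic_combination_nonneg` at `θ = artanh u`, divided by a power of `cosh θ`. Up to the
factor `-artanh u`, this is the numerator of the derivative in `biasEntropy_mul_le`. -/
theorem artanh_polynomial_nonneg {u : ℝ} (hu : u ∈ Ioo (0 : ℝ) 1) :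
    0 ≤ 2 * Real.artanh u ^ 3 * u * (3 + u ^ 2) * (1 - u ^ 2)
      - 5 * Real.artanh u ^ 2 * (1 + u ^ 2) * (1 - u ^ 2)
      + 4 * Real.artanh u * u * (1 - u ^ 2) + u ^ 2 := by
  have h := hyperbolic_combination_nonneg (Real.artanh u)
  set θ := Real.artanh u
  have hC := Real.cosh_pos θ
  have hSC : Real.sinh θ = u * Real.cosh θ := by
    have := Real.tanh_artanh (x := u) ⟨by linarith [hu.1], hu.2⟩
    rw [Real.tanh_eq_sinh_div_cosh, div_eq_iff hC.ne'] at this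
    exact this
  have hsq : Real.cosh θ ^ 2 * (1 - u ^ 2) = 1 := by
    have := Real.cosh_sq θ
    rw [hSC] at this
    linarith
  have h5 : Real.cosh (5 * θ) = Real.cosh (3 * θ) * Real.cosh (2 * θ)
      + Real.sinh (3 * θ) * Real.sinh (2 * θ) := by
    rw [← Real.cosh_add]; ring_nf
  rw [h5, Real.cosh_three_mul, Real.sinh_three_mul, Real.cosh_two_mul, Real.sinh_two_mul,
    hSC] at h
  set C := Real.cosh θ
  have hep : 0 < 1 - u ^ 2 := by nlinarith [hu.1, hu.2]
  have hCe : C ^ 2 = 1 / (1 - u ^ 2) := by rw [eq_div_iff hep.ne']; exact hsq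
  have h3 : C ^ 3 = C * (1 / (1 - u ^ 2)) := by rw [← hCe]; ring
  have key : ∀ E P : ℝ, E = C * P / (1 - u ^ 2) ^ 2 → 0 ≤ E → 0 ≤ P := by
    intro E P hE h0
    rw [hE] at h0
    by_contra hP
    push Not at hP
    exact absurd h0 (not_le.2 (div_neg_of_neg_of_pos (mul_neg_of_pos_of_neg hC hP) (by positivity)))
  refine key _ _ ?_ h
  simp only [mul_pow, h3, hCe]
  field_simp
  linear_combination 4 * u ^ 2 * (3 + u ^ 2) * hsq

theorem one_sub_sq_pos {u : ℝ} (hu : u ∈ Ioo (0 : ℝ) 1) : 0 < 1 - u ^ 2 := by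
  nlinarith [hu.1, hu.2]

theorem hasDerivAt_artanh' {u : ℝ} (hu : u ∈ Ioo (0 : ℝ) 1) :
    HasDerivAt Real.artanh (1 / (1 - u ^ 2)) u :=
  hasDerivAt_artanh ⟨by linarith [hu.1], hu.2⟩

theorem hasDerivAt_artanh_comp {f : ℝ → ℝ} {f' x : ℝ} (hf : HasDerivAt f f' x)
    (hx : f x ∈ Ioo (0 : ℝ) 1) :
    HasDerivAt (fun t => Real.artanh (f t)) (1 / (1 - f x ^ 2) * f') x :=
  HasDerivAt.comp (h₂ := Real.artanh) (h := f) x (hasDerivAt_artanh' hx) hf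

/-! ### The entropy of a bit as a function of its bias -/

/-- The Shannon entropy of a bit with bias `u`, that is, taking its two values with probabilities
`(1 + u) / 2` and `(1 - u) / 2`. -/
noncomputable def biasEntropy (u : ℝ) : ℝ := Real.binEntropy ((1 - u) / 2)

theorem continuous_biasEntropy : Continuous biasEntropy := by
  unfold biasEntropy
  fun_prop

theorem biasEntropy_zero : biasEntropy 0 = Real.log 2 := by
  rw [biasEntropy, sub_zero, one_div, Real.binEntropy_two_inv]

theorem biasEntropy_one : biasEntropy 1 = 0 := by
  simp [biasEntropy]

theorem biasEntropy_neg (u : ℝ) : biasEntropy (-u) = biasEntropy u := by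
  rw [biasEntropy, biasEntropy, ← Real.binEntropy_one_sub]
  ring_nf

theorem biasEntropy_abs (u : ℝ) : biasEntropy |u| = biasEntropy u := by
  rcases abs_choice u with h | h <;> rw [h]
  exact biasEntropy_neg u

theorem biasEntropy_le (u : ℝ) : biasEntropy u ≤ Real.log 2 := Real.binEntropy_le_log_two

theorem biasEntropy_nonneg {u : ℝ} (hu : u ∈ Icc (-1 : ℝ) 1) : 0 ≤ biasEntropy u :=
  Real.binEntropy_nonneg (by linarith [hu.2]) (by linarith [hu.1])

theorem strictAntiOn_biasEntropy : StrictAntiOn biasEntropy (Icc 0 1) := by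
  intro a ha b hb hab
  exact Real.binEntropy_strictMonoOn ⟨by linarith [hb.2], by linarith [hb.1]⟩
    ⟨by linarith [ha.2], by linarith [ha.1]⟩ (by linarith)

theorem hasDerivAt_biasEntropy {u : ℝ} (hu : u ∈ Ioo (-1 : ℝ) 1) :
    HasDerivAt biasEntropy (-Real.artanh u) u := by
  have h1 : 0 < 1 + u := by linarith [hu.1]
  have h2 : 0 < 1 - u := by linarith [hu.2]
  have hp : HasDerivAt (fun x : ℝ => (1 - x) / 2) (-1 / 2) u :=
    ((hasDerivAt_id u).const_sub 1).div_const 2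
  have h := (Real.hasDerivAt_binEntropy (p := (1 - u) / 2) (by linarith) (by linarith)).comp u hp
  refine h.congr_deriv ?_
  rw [Real.artanh_eq_half_log (Ioo_subset_Icc_self hu), Real.log_div h1.ne' h2.ne',
    show 1 - (1 - u) / 2 = (1 + u) / 2 by ring, Real.log_div h1.ne' two_ne_zero,
    Real.log_div h2.ne' two_ne_zero]
  ring

theorem hasDerivAt_biasEntropy_comp {f : ℝ → ℝ} {f' x : ℝ} (hf : HasDerivAt f f' x)
    (hx : f x ∈ Ioo (0 : ℝ) 1) :
    HasDerivAt (fun t => biasEntropy (f t)) (-Real.artanh (f x) * f') x :=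
  HasDerivAt.comp (h₂ := biasEntropy) (h := f) x
    (hasDerivAt_biasEntropy ⟨by linarith [hx.1], hx.2⟩) hf

theorem concaveOn_biasEntropy : ConcaveOn ℝ (Icc (-1) 1) biasEntropy := by
  have h := Real.strictConcave_binEntropy.concaveOn
  refine ⟨convex_Icc _ _, fun a ha b hb s t hs ht hst => ?_⟩
  have := h.2 (x := (1 - a) / 2) ⟨by linarith [ha.2], by linarith [ha.1]⟩
    (y := (1 - b) / 2) ⟨by linarith [hb.2], by linarith [hb.1]⟩ hs ht hst
  refine this.trans_eq ?_
  simp only [biasEntropy, smul_eq_mul]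
  congr 1
  linear_combination (1 / 2 : ℝ) * hst

/-- The term `p * log (1 / p)` of the entropy, `p = (1 - v) / 2`, alone dominates the left-hand
side. -/
theorem one_sub_sq_mul_artanh_le_biasEntropy {v : ℝ} (hv : v ∈ Ioo (0 : ℝ) 1) :
    (1 - v ^ 2) / 2 * (v * Real.artanh v) ≤ biasEntropy v := by
  have h1 : 0 < 1 + v := by linarith [hv.1]
  have h2 : 0 < 1 - v := by linarith [hv.2]
  set p := (1 - v) / 2 with hp
  have hp0 : 0 < p := by linarith
  have hp1 : p < 1 := by linarith [hv.1]
  have hlp : Real.log p ≤ 0 := Real.log_nonpos hp0.le hp1.le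
  have hlq : Real.log (1 - p) ≤ 0 := Real.log_nonpos (by linarith) (by linarith)
  have hT : Real.artanh v = 1 / 2 * (Real.log (1 - p) - Real.log p) := by
    rw [Real.artanh_eq_half_log ⟨by linarith, by linarith⟩, Real.log_div h1.ne' h2.ne',
      show 1 - p = (1 + v) / 2 by rw [hp]; ring, Real.log_div h1.ne' two_ne_zero,
      Real.log_div h2.ne' two_ne_zero]
    ring
  have hTle : Real.artanh v ≤ -(1 / 2) * Real.log p := by rw [hT]; linarith
  have hk : p * -Real.log p ≤ biasEntropy v := by
    have : biasEntropy v = p * -Real.log p + (1 - p) * -Real.log (1 - p) := by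
      rw [biasEntropy, ← hp, Real.binEntropy_eq_negMulLog_add_negMulLog_one_sub]
      simp only [Real.negMulLog]
      ring
    nlinarith
  have hc : (1 - v ^ 2) / 2 * v ≤ 2 * p := by
    rw [hp]; nlinarith [hv.1, hv.2, mul_pos h1 h2]
  calc (1 - v ^ 2) / 2 * (v * Real.artanh v) = (1 - v ^ 2) / 2 * v * Real.artanh v := by ring
    _ ≤ 2 * p * Real.artanh v :=
      mul_le_mul_of_nonneg_right hc (Real.artanh_pos hv).le
    _ ≤ 2 * p * (-(1 / 2) * Real.log p) := mul_le_mul_of_nonneg_left hTle (by positivity)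
    _ = p * -Real.log p := by ring
    _ ≤ biasEntropy v := hk

theorem one_add_sq_mul_artanh_sub_pos {u : ℝ} (hu : u ∈ Ioo (0 : ℝ) 1) :
    0 < (1 + u ^ 2) * Real.artanh u - u := by
  have := le_artanh (Ioo_subset_Ico_self hu)
  nlinarith [hu.1, Real.artanh_pos hu, mul_pos (pow_pos hu.1 2) (Real.artanh_pos hu)]

/-- An upper bound for `biasEntropy u` by a quotient `M u`, cleared of its denominator. Both
`biasEntropy` and `M` tend to `0` at `1`, and `M - biasEntropy` is antitone by
`artanh_polynomial_nonneg`. -/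
theorem biasEntropy_mul_le {u : ℝ} (hu : u ∈ Ioo (0 : ℝ) 1) :
    ((1 + u ^ 2) * Real.artanh u - u) * biasEntropy u
      ≤ (1 - u ^ 2) * Real.artanh u ^ 2 * (u + (1 - u ^ 2) * Real.artanh u) := by
  set M : ℝ → ℝ := fun u => (1 - u ^ 2) * Real.artanh u ^ 2 * (u + (1 - u ^ 2) * Real.artanh u)
    / ((1 + u ^ 2) * Real.artanh u - u) with hM
  have hMpos : ∀ x ∈ Ioo (0 : ℝ) 1, 0 ≤ M x := by
    intro x hx
    have h1 := one_sub_sq_pos hx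
    have h2 := one_add_sq_mul_artanh_sub_pos hx
    have h3 := Real.artanh_pos hx
    have h4 := hx.1
    positivity
  have hd : ∀ x ∈ Ioo (0 : ℝ) 1, HasDerivAt (fun u => M u - biasEntropy u)
      (-Real.artanh x * (2 * Real.artanh x ^ 3 * x * (3 + x ^ 2) * (1 - x ^ 2)
      - 5 * Real.artanh x ^ 2 * (1 + x ^ 2) * (1 - x ^ 2)
      + 4 * Real.artanh x * x * (1 - x ^ 2) + x ^ 2) /
        ((1 + x ^ 2) * Real.artanh x - x) ^ 2) x := by
    intro x hx
    have h1 := (one_sub_sq_pos hx).ne'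
    have h2 := (one_add_sq_mul_artanh_sub_pos hx).ne'
    have hT := hasDerivAt_artanh' hx
    have hk := hasDerivAt_biasEntropy (u := x) ⟨by linarith [hx.1], hx.2⟩
    have hsq : HasDerivAt (fun y : ℝ => y ^ 2) (2 * x) x := by
      simpa using hasDerivAt_pow 2 x
    have hA := (hsq.const_sub 1).mul (hT.pow 2)
    have hB := (hasDerivAt_id x).add ((hsq.const_sub 1).mul hT)
    have hD := ((hsq.const_add 1).mul hT).sub (hasDerivAt_id x)
    refine (((hA.mul hB).div hD h2).sub hk).congr_deriv ?_
    simp only [Pi.mul_apply, Pi.add_apply, Pi.sub_apply, Pi.pow_apply, id]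
    rw [sub_neg_eq_add, div_add' _ _ _ (by exact pow_ne_zero 2 h2)]
    congr 1
    field_simp
    ring
  have hanti : AntitoneOn (fun u => M u - biasEntropy u) (Ioo 0 1) := by
    refine antitoneOn_of_hasDerivWithinAt_nonpos (convex_Ioo 0 1)
      (fun x hx => (hd x hx).continuousAt.continuousWithinAt)
      (fun x hx => (hd x (interior_subset hx)).hasDerivWithinAt) (fun x hx => ?_)
    have hx' := interior_subset hx
    exact div_nonpos_of_nonpos_of_nonneg (mul_nonpos_of_nonpos_of_nonneg
      (neg_nonpos.2 (Real.artanh_pos hx').le) (artanh_polynomial_nonneg hx')) (sq_nonneg _)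
  have hlim : Filter.Tendsto (fun w => -biasEntropy w) (nhdsWithin 1 (Iio 1)) (nhds 0) := by
    have := continuous_biasEntropy.neg.tendsto 1
    rw [Pi.neg_apply, biasEntropy_one, neg_zero] at this
    exact this.mono_left nhdsWithin_le_nhds
  have h0 : 0 ≤ M u - biasEntropy u := by
    refine le_of_tendsto hlim ?_
    filter_upwards [Ioo_mem_nhdsLT hu.2] with w hw
    have hw' : w ∈ Ioo (0 : ℝ) 1 := ⟨hu.1.trans hw.1, hw.2⟩
    -- `M` is nonnegative, so the limit of `M` at `1` is not needed.
    have h1 := hanti hu hw' hw.1.le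
    have := hMpos w hw'
    simp only at h1
    linarith
  have h1 : biasEntropy u ≤ M u := by linarith
  rw [hM, le_div_iff₀ (one_add_sq_mul_artanh_sub_pos hu)] at h1
  linarith

/-! ### The elasticity of `artanh` -/

/-- The logarithmic derivative `u T'(u) / T(u)` of `T = artanh` with respect to `log u`. -/
noncomputable def artanhElasticity (u : ℝ) : ℝ := u / ((1 - u ^ 2) * Real.artanh u)

theorem artanhElasticity_pos {u : ℝ} (hu : u ∈ Ioo (0 : ℝ) 1) : 0 < artanhElasticity u :=
  div_pos hu.1 (mul_pos (one_sub_sq_pos hu) (Real.artanh_pos hu))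

theorem hasDerivAt_artanhElasticity {u : ℝ} (hu : u ∈ Ioo (0 : ℝ) 1) :
    HasDerivAt artanhElasticity
      (((1 + u ^ 2) * Real.artanh u - u) / ((1 - u ^ 2) * Real.artanh u) ^ 2) u := by
  have h1 := (one_sub_sq_pos hu).ne'
  have h3 := (Real.artanh_pos hu).ne'
  have hsq : HasDerivAt (fun y : ℝ => y ^ 2) (2 * u) u := by
    simpa using hasDerivAt_pow 2 u
  have h := (hasDerivAt_id u).div ((hsq.const_sub 1).mul (hasDerivAt_artanh' hu))
    (mul_ne_zero h1 h3)
  refine h.congr_deriv ?_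
  simp only [Pi.mul_apply, id]
  congr 1
  field_simp
  ring

theorem monotoneOn_artanhElasticity : MonotoneOn artanhElasticity (Ioo 0 1) := by
  refine monotoneOn_of_hasDerivWithinAt_nonneg (convex_Ioo 0 1)
    (fun x hx => (hasDerivAt_artanhElasticity hx).continuousAt.continuousWithinAt)
    (fun x hx => (hasDerivAt_artanhElasticity (interior_subset hx)).hasDerivWithinAt)
    (fun x hx => ?_)
  exact div_nonneg (one_add_sq_mul_artanh_sub_pos (interior_subset hx)).le (sq_nonneg _)

/-- The sign of the derivative is `biasEntropy_mul_le`. -/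
theorem antitoneOn_one_add_artanhElasticity_mul_biasEntropy :
    AntitoneOn (fun u => (1 + artanhElasticity u) * biasEntropy u) (Ioo 0 1) := by
  have hd : ∀ x ∈ Ioo (0 : ℝ) 1,
      HasDerivAt (fun u => (1 + artanhElasticity u) * biasEntropy u)
        ((((1 + x ^ 2) * Real.artanh x - x) * biasEntropy x
          - (1 - x ^ 2) * Real.artanh x ^ 2 * (x + (1 - x ^ 2) * Real.artanh x))
          / ((1 - x ^ 2) * Real.artanh x) ^ 2) x := by
    intro x hx
    have h1 := (one_sub_sq_pos hx).ne'
    have h3 := (Real.artanh_pos hx).ne'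
    refine (((hasDerivAt_artanhElasticity hx).const_add 1).mul
      (hasDerivAt_biasEntropy ⟨by linarith [hx.1], hx.2⟩)).congr_deriv ?_
    rw [artanhElasticity]
    field_simp
    ring
  refine antitoneOn_of_hasDerivWithinAt_nonpos (convex_Ioo 0 1)
    (fun x hx => (hd x hx).continuousAt.continuousWithinAt)
    (fun x hx => (hd x (interior_subset hx)).hasDerivWithinAt) (fun x hx => ?_)
  exact div_nonpos_of_nonpos_of_nonneg
    (sub_nonpos.2 (biasEntropy_mul_le (interior_subset hx))) (sq_nonneg _)

theorem mul_mem_Ioo {u v : ℝ} (hu : u ∈ Ioo (0 : ℝ) 1) (hv : v ∈ Ioo (0 : ℝ) 1) :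
    u * v ∈ Ioo (0 : ℝ) 1 :=
  ⟨mul_pos hu.1 hv.1, mul_lt_one_of_nonneg_of_lt_one_left hu.1.le hu.2 hv.2.le⟩

theorem antitoneOn_div_artanh : AntitoneOn (fun u => u / Real.artanh u) (Ioo 0 1) := by
  have hd : ∀ x ∈ Ioo (0 : ℝ) 1, HasDerivAt (fun u => u / Real.artanh u)
      ((Real.artanh x - x / (1 - x ^ 2)) / Real.artanh x ^ 2) x := by
    intro x hx
    refine ((hasDerivAt_id x).div (hasDerivAt_artanh' hx) (Real.artanh_pos hx).ne').congr_deriv ?_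
    simp only [id]
    congr 1
    ring
  refine antitoneOn_of_hasDerivWithinAt_nonpos (convex_Ioo 0 1)
    (fun x hx => (hd x hx).continuousAt.continuousWithinAt)
    (fun x hx => (hd x (interior_subset hx)).hasDerivWithinAt) (fun x hx => ?_)
  exact div_nonpos_of_nonpos_of_nonneg
    (sub_nonpos.2 (artanh_le_div (Ioo_subset_Ico_self (interior_subset hx)))) (sq_nonneg _)

theorem artanh_mul_le {u v : ℝ} (hu : u ∈ Ioo (0 : ℝ) 1) (hv : v ∈ Ioo (0 : ℝ) 1) :
    Real.artanh (u * v) ≤ v * Real.artanh u := by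
  have huv := mul_mem_Ioo hu hv
  have h : u / Real.artanh u ≤ u * v / Real.artanh (u * v) :=
    antitoneOn_div_artanh huv hu (mul_le_of_le_one_right hu.1.le hv.2.le)
  rw [div_le_div_iff₀ (Real.artanh_pos hu) (Real.artanh_pos huv)] at h
  have := hu.1
  nlinarith

theorem biasEntropy_mul_sub_le {u v : ℝ} (hu : u ∈ Ioo (0 : ℝ) 1) (hv : v ∈ Ioo (0 : ℝ) 1) :
    biasEntropy (u * v) - biasEntropy u ≤ u * Real.artanh u * ((1 - v ^ 2) / 2) := by
  have hd : ∀ x ∈ Ioo (0 : ℝ) 1,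
      HasDerivAt (fun v => u * Real.artanh u * ((1 - v ^ 2) / 2) - biasEntropy (u * v))
        (u * (Real.artanh (u * x) - x * Real.artanh u)) x := by
    intro x hx
    have hux := mul_mem_Ioo hu hx
    have hsq : HasDerivAt (fun y : ℝ => y ^ 2) (2 * x) x := by
      simpa using hasDerivAt_pow 2 x
    have hm : HasDerivAt (fun y : ℝ => u * y) u x := by
      simpa using (hasDerivAt_id x).const_mul u
    have hk := (hasDerivAt_biasEntropy (u := u * x) ⟨by linarith [hux.1], hux.2⟩).comp x hm
    refine ((((hsq.const_sub 1).div_const 2).const_mul (u * Real.artanh u)).sub hk).congr_deriv ?_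
    ring
  have hanti : AntitoneOn (fun v => u * Real.artanh u * ((1 - v ^ 2) / 2) - biasEntropy (u * v))
      (Icc 0 1) := by
    refine antitoneOn_of_hasDerivWithinAt_nonpos (convex_Icc 0 1) ?_
      (fun x hx => (hd x (by rwa [interior_Icc] at hx)).hasDerivWithinAt) (fun x hx => ?_)
    · have := continuous_biasEntropy
      fun_prop
    · rw [interior_Icc] at hx
      exact mul_nonpos_of_nonneg_of_nonpos hu.1.le (sub_nonpos.2 (artanh_mul_le hu hx))
  have := hanti (Ioo_subset_Icc_self hv) (right_mem_Icc.2 zero_le_one) hv.2.le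
  simp only [one_pow, sub_self, zero_div, mul_zero, mul_one] at this
  linarith

/-- Division-free form of `(r u + r v) (1 + ℓ (u v)) ≥ r u (1 + ℓ u)` with
`r u = biasEntropy u / (u * artanh u)` and `ℓ = artanhElasticity`. -/
theorem elasticity_ineq_biasEntropy {u v : ℝ} (hu : u ∈ Ioo (0 : ℝ) 1) (hv : v ∈ Ioo (0 : ℝ) 1) :
    biasEntropy u * (v * Real.artanh v) * (1 + artanhElasticity u) ≤
      (biasEntropy u * (v * Real.artanh v) + biasEntropy v * (u * Real.artanh u))
        * (1 + artanhElasticity (u * v)) := by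
  have huv := mul_mem_Ioo hu hv
  have h1 := antitoneOn_one_add_artanhElasticity_mul_biasEntropy huv hu
    (mul_le_of_le_one_right hu.1.le hv.2.le)
  have h2 := biasEntropy_mul_sub_le hu hv
  have h3 := one_sub_sq_mul_artanh_le_biasEntropy hv
  have hTu := mul_pos hu.1 (Real.artanh_pos hu)
  have hTv := mul_pos hv.1 (Real.artanh_pos hv)
  have hl : 0 < 1 + artanhElasticity (u * v) := by linarith [artanhElasticity_pos huv]
  simp only at h1
  calc biasEntropy u * (v * Real.artanh v) * (1 + artanhElasticity u)
      = (1 + artanhElasticity u) * biasEntropy u * (v * Real.artanh v) := by ring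
    _ ≤ (1 + artanhElasticity (u * v)) * biasEntropy (u * v) * (v * Real.artanh v) :=
        mul_le_mul_of_nonneg_right h1 hTv.le
    _ = biasEntropy (u * v) * (v * Real.artanh v) * (1 + artanhElasticity (u * v)) := by ring
    _ ≤ _ := by
        refine mul_le_mul_of_nonneg_right ?_ hl.le
        nlinarith [mul_le_mul_of_nonneg_right h2 hTv.le, mul_le_mul_of_nonneg_left h3 hTu.le]

theorem log_two_sub_biasEntropy_le {v : ℝ} (hv : v ∈ Ioo (0 : ℝ) 1) :
    2 * (Real.log 2 - biasEntropy v) ≤ v * Real.artanh v := by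
  have hd : ∀ x ∈ Ico (0 : ℝ) 1,
      HasDerivAt (fun v => v * Real.artanh v - 2 * (Real.log 2 - biasEntropy v))
        (x / (1 - x ^ 2) - Real.artanh x) x := by
    intro x hx
    have hx' : x ∈ Ioo (-1 : ℝ) 1 := ⟨by linarith [hx.1], hx.2⟩
    refine (((hasDerivAt_id x).mul (hasDerivAt_artanh hx')).sub
      (((hasDerivAt_biasEntropy hx').const_sub (Real.log 2)).const_mul 2)).congr_deriv ?_
    simp only [id]
    ring
  have hm : MonotoneOn (fun v => v * Real.artanh v - 2 * (Real.log 2 - biasEntropy v))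
      (Ico 0 1) := by
    refine monotoneOn_of_hasDerivWithinAt_nonneg (convex_Ico 0 1)
      (fun x hx => (hd x hx).continuousAt.continuousWithinAt)
      (fun x hx => (hd x (interior_subset hx)).hasDerivWithinAt) (fun x hx => ?_)
    exact sub_nonneg.2 (artanh_le_div (interior_subset hx))
  have := hm (left_mem_Ico.2 one_pos) (Ioo_subset_Ico_self hv) hv.1.le
  simp only [zero_mul, biasEntropy_zero, sub_self, mul_zero] at this
  linarith

theorem monotoneOn_log_two_sub_biasEntropy_div :
    MonotoneOn (fun v => (Real.log 2 - biasEntropy v) / (v * Real.artanh v * (1 - v ^ 2)))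
      (Ioo 0 1) := by
  have hd : ∀ x ∈ Ioo (0 : ℝ) 1,
      HasDerivAt (fun v => (Real.log 2 - biasEntropy v) / (v * Real.artanh v * (1 - v ^ 2)))
        ((Real.artanh x * (x * Real.artanh x * (1 - x ^ 2))
          - (Real.log 2 - biasEntropy x) * ((1 - 3 * x ^ 2) * Real.artanh x + x))
          / (x * Real.artanh x * (1 - x ^ 2)) ^ 2) x := by
    intro x hx
    have h1 := (one_sub_sq_pos hx).ne'
    have h3 := (Real.artanh_pos hx).ne'
    have hsq : HasDerivAt (fun y : ℝ => y ^ 2) (2 * x) x := by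
      simpa using hasDerivAt_pow 2 x
    have hk := (hasDerivAt_biasEntropy (u := x) ⟨by linarith [hx.1], hx.2⟩).const_sub (Real.log 2)
    refine (hk.div (((hasDerivAt_id x).mul (hasDerivAt_artanh' hx)).mul (hsq.const_sub 1))
      (mul_ne_zero (mul_ne_zero hx.1.ne' h3) h1)).congr_deriv ?_
    simp only [Pi.mul_apply, id]
    congr 1
    field_simp
    ring
  refine monotoneOn_of_hasDerivWithinAt_nonneg (convex_Ioo 0 1)
    (fun x hx => (hd x hx).continuousAt.continuousWithinAt)
    (fun x hx => (hd x (interior_subset hx)).hasDerivWithinAt) (fun x hx => ?_)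
  rw [interior_Ioo] at hx
  refine div_nonneg ?_ (sq_nonneg _)
  have hT := Real.artanh_pos hx
  have hK : 0 ≤ Real.log 2 - biasEntropy x := sub_nonneg.2 (biasEntropy_le x)
  have hK2 := log_two_sub_biasEntropy_le hx
  have hx2 := one_sub_sq_pos hx
  have hle := le_artanh (Ioo_subset_Ico_self hx)
  have hx0 := hx.1
  rcases le_total ((1 - 3 * x ^ 2) * Real.artanh x + x) 0 with h | h
  · have : 0 ≤ Real.artanh x * (x * Real.artanh x * (1 - x ^ 2)) := by positivity
    nlinarith [mul_nonneg hK (neg_nonneg.2 h)]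
  -- With `2 K ≤ x T`, the claim becomes `x ≤ (1 + x ^ 2) T`.
  · have h5 := mul_le_mul_of_nonneg_right hK2 h
    have h6 : x ≤ (1 + x ^ 2) * Real.artanh x := by nlinarith [mul_pos (pow_pos hx0 2) hT]
    have h7 := mul_le_mul_of_nonneg_left h6 (mul_pos hx0 hT).le
    nlinarith

theorem antitoneOn_one_sub_sq_mul_artanhElasticity :
    AntitoneOn (fun u => (1 - u ^ 2) * (1 + artanhElasticity u)) (Ioo 0 1) := by
  intro a ha b hb hab
  have h := antitoneOn_div_artanh ha hb hab
  have e : ∀ x ∈ Ioo (0 : ℝ) 1, (1 - x ^ 2) * (1 + artanhElasticity x)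
      = 1 - x ^ 2 + x / Real.artanh x := by
    intro x hx
    have h1 := (one_sub_sq_pos hx).ne'
    have h3 := (Real.artanh_pos hx).ne'
    rw [artanhElasticity]
    field_simp
  simp only at h ⊢
  rw [e a ha, e b hb]
  nlinarith [ha.1]

/-- Division-free form of `(q u + q v) (1 + ℓ (u v)) ≥ q u (1 + ℓ u)` with
`q u = (log 2 - biasEntropy u) / (u * artanh u)` and `ℓ = artanhElasticity`. Unlike
`elasticity_ineq_biasEntropy`, it needs `u ≤ v`. -/
theorem elasticity_ineq_log_two_sub_biasEntropy {u v : ℝ} (hu : u ∈ Ioo (0 : ℝ) 1)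
    (hv : v ∈ Ioo (0 : ℝ) 1) (huv : u ≤ v) :
    (Real.log 2 - biasEntropy u) * (v * Real.artanh v) * (1 + artanhElasticity u) ≤
      ((Real.log 2 - biasEntropy u) * (v * Real.artanh v)
        + (Real.log 2 - biasEntropy v) * (u * Real.artanh u))
        * (1 + artanhElasticity (u * v)) := by
  have hw := mul_mem_Ioo hu hv
  have h1 := antitoneOn_one_sub_sq_mul_artanhElasticity hw hu
    (mul_le_of_le_one_right hu.1.le hv.2.le)
  have h2 := monotoneOn_log_two_sub_biasEntropy_div hu hv huv
  have hTu := mul_pos hu.1 (Real.artanh_pos hu)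
  have hTv := mul_pos hv.1 (Real.artanh_pos hv)
  have hu2 := one_sub_sq_pos hu
  have hv2 := one_sub_sq_pos hv
  have hl : 0 < 1 + artanhElasticity (u * v) := by linarith [artanhElasticity_pos hw]
  have hKu : 0 ≤ Real.log 2 - biasEntropy u := sub_nonneg.2 (biasEntropy_le u)
  simp only at h1 h2
  rw [div_le_div_iff₀ (by positivity) (by positivity)] at h2
  set a := (Real.log 2 - biasEntropy u) * (v * Real.artanh v) with ha
  set b := (Real.log 2 - biasEntropy v) * (u * Real.artanh u) with hb
  have ha0 : 0 ≤ a := mul_nonneg hKu hTv.le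
  have hab : a * (1 - v ^ 2) ≤ b * (1 - u ^ 2) := by rw [ha, hb]; linarith
  have hab' : a * (1 - (u * v) ^ 2) ≤ (a + b) * (1 - u ^ 2) := by
    have : u ^ 2 * (a * (1 - v ^ 2)) ≤ 1 * (a * (1 - v ^ 2)) :=
      mul_le_mul_of_nonneg_right (by linarith) (by positivity)
    nlinarith
  refine le_of_mul_le_mul_left ?_ hu2
  calc (1 - u ^ 2) * (a * (1 + artanhElasticity u))
      = a * ((1 - u ^ 2) * (1 + artanhElasticity u)) := by ring
    _ ≤ a * ((1 - (u * v) ^ 2) * (1 + artanhElasticity (u * v))) :=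
        mul_le_mul_of_nonneg_left h1 ha0
    _ = a * (1 - (u * v) ^ 2) * (1 + artanhElasticity (u * v)) := by ring
    _ ≤ (a + b) * (1 - u ^ 2) * (1 + artanhElasticity (u * v)) :=
        mul_le_mul_of_nonneg_right hab' hl.le
    _ = _ := by ring

/-! ### The function `f₂` in terms of biases -/

theorem log_two_pos : 0 < Real.log 2 := Real.log_pos one_lt_two

/-- The inverse of `biasEntropy : [0, 1] → [0, log 2]`. -/
noncomputable def bias (x : ℝ) : ℝ := 1 - 2 * binEntropyInv x

theorem bias_mem {x : ℝ} (hx : x ∈ Icc 0 (Real.log 2)) : bias x ∈ Icc (0 : ℝ) 1 := by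
  have h := binEntropyInv_mem hx
  rw [bias]
  constructor <;> norm_num at h <;> linarith [h.1, h.2]

theorem biasEntropy_bias {x : ℝ} (hx : x ∈ Icc 0 (Real.log 2)) : biasEntropy (bias x) = x := by
  rw [biasEntropy, bias, show (1 - (1 - 2 * binEntropyInv x)) / 2 = binEntropyInv x by ring,
    binEntropy_binEntropyInv hx]

theorem bias_biasEntropy {u : ℝ} (hu : u ∈ Icc (0 : ℝ) 1) : bias (biasEntropy u) = u := by
  rw [bias, biasEntropy, binEntropyInv_binEntropy ⟨by linarith [hu.2], by linarith [hu.1]⟩]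
  ring

theorem bias_zero : bias 0 = 1 := by
  rw [← biasEntropy_one, bias_biasEntropy (right_mem_Icc.2 zero_le_one)]

theorem bias_log_two : bias (Real.log 2) = 0 := by
  rw [← biasEntropy_zero, bias_biasEntropy (left_mem_Icc.2 zero_le_one)]

theorem strictAntiOn_bias : StrictAntiOn bias (Icc 0 (Real.log 2)) := by
  intro x hx y hy hxy
  by_contra h
  have := strictAntiOn_biasEntropy.antitoneOn (bias_mem hx) (bias_mem hy) (not_lt.1 h)
  rw [biasEntropy_bias hx, biasEntropy_bias hy] at this
  linarith

theorem bias_mem_Ioo {x : ℝ} (hx : x ∈ Ioo 0 (Real.log 2)) : bias x ∈ Ioo (0 : ℝ) 1 := by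
  have hL := log_two_pos.le
  have h1 := strictAntiOn_bias (left_mem_Icc.2 hL) (Ioo_subset_Icc_self hx) hx.1
  have h2 := strictAntiOn_bias (Ioo_subset_Icc_self hx) (right_mem_Icc.2 hL) hx.2
  rw [bias_zero] at h1
  rw [bias_log_two] at h2
  exact ⟨h2, h1⟩

theorem continuousOn_bias : ContinuousOn bias (Icc 0 (Real.log 2)) := by
  rw [continuousOn_iff_isClosed]
  intro C hC
  refine ⟨biasEntropy '' (C ∩ Icc 0 1),
    ((isCompact_Icc.inter_left hC).image continuous_biasEntropy).isClosed, ?_⟩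
  ext x
  constructor
  · rintro ⟨hxC, hx⟩
    exact ⟨⟨bias x, ⟨hxC, bias_mem hx⟩, biasEntropy_bias hx⟩, hx⟩
  · rintro ⟨⟨u, ⟨huC, hu⟩, rfl⟩, hx⟩
    refine ⟨?_, hx⟩
    rw [mem_preimage, bias_biasEntropy hu]
    exact huC

theorem hasDerivAt_bias {x : ℝ} (hx : x ∈ Ioo 0 (Real.log 2)) :
    HasDerivAt bias (-Real.artanh (bias x))⁻¹ x := by
  have hb := bias_mem_Ioo hx
  refine HasDerivAt.of_local_left_inverse
    (continuousOn_bias.continuousAt (Icc_mem_nhds hx.1 hx.2))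
    (hasDerivAt_biasEntropy ⟨by linarith [hb.1], hb.2⟩)
    (neg_ne_zero.2 (Real.artanh_pos hb).ne') ?_
  filter_upwards [Icc_mem_nhds hx.1 hx.2] with y hy
  exact biasEntropy_bias hy

theorem f₂_eq (x y : ℝ) : f₂ x y = biasEntropy (bias x * bias y) := by
  rw [f₂, biasEntropy, binConv, bias, bias]
  congr 1
  ring

theorem f₂_comm (x y : ℝ) : f₂ x y = f₂ y x := by
  rw [f₂_eq, f₂_eq, mul_comm]

theorem f₂_zero_right {x : ℝ} (hx : x ∈ Icc 0 (Real.log 2)) : f₂ x 0 = x := by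
  rw [f₂_eq, bias_zero, mul_one, biasEntropy_bias hx]

theorem f₂_zero_left {x : ℝ} (hx : x ∈ Icc 0 (Real.log 2)) : f₂ 0 x = x := by
  rw [f₂_comm, f₂_zero_right hx]

theorem f₂_log_two_right (x : ℝ) : f₂ x (Real.log 2) = Real.log 2 := by
  rw [f₂_eq, bias_log_two, mul_zero, biasEntropy_zero]

theorem f₂_log_two_left (x : ℝ) : f₂ (Real.log 2) x = Real.log 2 := by
  rw [f₂_comm, f₂_log_two_right]

theorem bias_mul_bias_mem {x y : ℝ} (hx : x ∈ Icc 0 (Real.log 2)) (hy : y ∈ Icc 0 (Real.log 2)) :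
    bias x * bias y ∈ Icc (0 : ℝ) 1 :=
  ⟨mul_nonneg (bias_mem hx).1 (bias_mem hy).1,
    mul_le_one₀ (bias_mem hx).2 (bias_mem hy).1 (bias_mem hy).2⟩

theorem le_f₂_left {x y : ℝ} (hx : x ∈ Icc 0 (Real.log 2)) (hy : y ∈ Icc 0 (Real.log 2)) :
    x ≤ f₂ x y := by
  have h := strictAntiOn_biasEntropy.antitoneOn (bias_mul_bias_mem hx hy) (bias_mem hx)
    (mul_le_of_le_one_right (bias_mem hx).1 (bias_mem hy).2)
  rwa [biasEntropy_bias hx, ← f₂_eq] at h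

theorem le_f₂_right {x y : ℝ} (hx : x ∈ Icc 0 (Real.log 2)) (hy : y ∈ Icc 0 (Real.log 2)) :
    y ≤ f₂ x y := by
  rw [f₂_comm]
  exact le_f₂_left hy hx

theorem monotoneOn_f₂_left {y : ℝ} (hy : y ∈ Icc 0 (Real.log 2)) :
    MonotoneOn (fun x => f₂ x y) (Icc 0 (Real.log 2)) := by
  intro a ha b hb hab
  simp only [f₂_eq]
  exact strictAntiOn_biasEntropy.antitoneOn (bias_mul_bias_mem hb hy) (bias_mul_bias_mem ha hy)
    (mul_le_mul_of_nonneg_right (strictAntiOn_bias.antitoneOn ha hb hab) (bias_mem hy).1)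

theorem continuousOn_f₂_left (y : ℝ) : ContinuousOn (fun x => f₂ x y) (Icc 0 (Real.log 2)) := by
  simp only [f₂_eq]
  exact continuous_biasEntropy.comp_continuousOn (continuousOn_bias.mul continuousOn_const)

/-! ### The partial derivative of `f₂` and Mrs. Gerber's lemma -/

/-- The partial derivative of `f₂` in its first argument, valid for `x` in the open interval
`(0, log 2)`. -/
noncomputable def f₂Slope (x y : ℝ) : ℝ :=
  bias y * Real.artanh (bias x * bias y) / Real.artanh (bias x)

theorem hasDerivAt_f₂_left {x y : ℝ} (hx : x ∈ Ioo 0 (Real.log 2)) (hy : y ∈ Icc 0 (Real.log 2)) :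
    HasDerivAt (fun x => f₂ x y) (f₂Slope x y) x := by
  have hu := bias_mem_Ioo hx
  have hv := bias_mem hy
  have hT := (Real.artanh_pos hu).ne'
  have huv : bias x * bias y ∈ Ioo (-1 : ℝ) 1 :=
    ⟨by nlinarith [mul_nonneg hu.1.le hv.1], by nlinarith [hu.1, hu.2, hv.2]⟩
  have h := (hasDerivAt_biasEntropy huv).comp x ((hasDerivAt_bias hx).mul_const (bias y))
  have e : (fun x => f₂ x y) = biasEntropy ∘ fun x => bias x * bias y := by
    ext x
    exact f₂_eq x y
  rw [e]
  refine h.congr_deriv ?_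
  rw [f₂Slope]
  field_simp

theorem f₂Slope_le_one {x y : ℝ} (hx : x ∈ Ioo 0 (Real.log 2)) (hy : y ∈ Icc 0 (Real.log 2)) :
    f₂Slope x y ≤ 1 := by
  have hu := bias_mem_Ioo hx
  have hv := bias_mem hy
  have hT := Real.artanh_pos hu
  rw [f₂Slope, div_le_one hT]
  have h1 : Real.artanh (bias x * bias y) ≤ Real.artanh (bias x) :=
    Real.artanh_le_artanh (by nlinarith [mul_nonneg hu.1.le hv.1]) hu.2
      (mul_le_of_le_one_right hu.1.le hv.2)
  have h2 := mul_le_mul_of_nonneg_left h1 hv.1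
  nlinarith [hv.2]

/-- `f₂` is `1`-Lipschitz in each argument. -/
theorem f₂_sub_le {x x' y : ℝ} (hx : x ∈ Icc 0 (Real.log 2)) (hx' : x' ∈ Icc 0 (Real.log 2))
    (hy : y ∈ Icc 0 (Real.log 2)) (h : x ≤ x') : f₂ x' y - f₂ x y ≤ x' - x := by
  have hm : MonotoneOn (fun x => x - f₂ x y) (Icc 0 (Real.log 2)) := by
    refine monotoneOn_of_hasDerivWithinAt_nonneg (f' := fun x => 1 - f₂Slope x y) (convex_Icc _ _)
      (continuousOn_id.sub (continuousOn_f₂_left y)) (fun z hz => ?_) (fun z hz => ?_)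
    · rw [interior_Icc] at hz
      exact ((hasDerivAt_id z).sub (hasDerivAt_f₂_left hz hy)).hasDerivWithinAt
    · rw [interior_Icc] at hz
      exact sub_nonneg.2 (f₂Slope_le_one hz hy)
  have := hm hx hx' h
  simp only at this
  linarith

theorem hasDerivAt_artanh_mul_div_artanh {u v : ℝ} (hu : u ∈ Ioo (0 : ℝ) 1)
    (hv : v ∈ Ioo (0 : ℝ) 1) :
    HasDerivAt (fun u => Real.artanh (u * v) / Real.artanh u)
      (Real.artanh (u * v) / Real.artanh u *
        ((artanhElasticity (u * v) - artanhElasticity u) / u)) u := by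
  have huv := mul_mem_Ioo hu hv
  have hT := (Real.artanh_pos hu).ne'
  have hTT := (Real.artanh_pos huv).ne'
  have h1 := (one_sub_sq_pos hu).ne'
  have h2 := (one_sub_sq_pos huv).ne'
  have hu0 := hu.1.ne'
  have hv0 := hv.1.ne'
  have hm : HasDerivAt (fun y : ℝ => y * v) v u := by
    simpa using (hasDerivAt_id u).mul_const v
  have h := ((hasDerivAt_artanh' huv).comp u hm).div (hasDerivAt_artanh' hu) hT
  refine h.congr_deriv ?_
  simp only [artanhElasticity, Function.comp]
  field_simp

theorem antitoneOn_artanh_mul_div_artanh {v : ℝ} (hv : v ∈ Ioo (0 : ℝ) 1) :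
    AntitoneOn (fun u => Real.artanh (u * v) / Real.artanh u) (Ioo 0 1) := by
  refine antitoneOn_of_hasDerivWithinAt_nonpos (convex_Ioo 0 1)
    (fun x hx => (hasDerivAt_artanh_mul_div_artanh hx hv).continuousAt.continuousWithinAt)
    (fun x hx => (hasDerivAt_artanh_mul_div_artanh (interior_subset hx) hv).hasDerivWithinAt)
    (fun x hx => ?_)
  have hx' := interior_subset hx
  have huv := mul_mem_Ioo hx' hv
  refine mul_nonpos_of_nonneg_of_nonpos
    (div_pos (Real.artanh_pos huv) (Real.artanh_pos hx')).le
    (div_nonpos_of_nonpos_of_nonneg (sub_nonpos.2 ?_) hx'.1.le)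
  exact monotoneOn_artanhElasticity huv hx' (mul_le_of_le_one_right hx'.1.le hv.2.le)

theorem f₂Slope_mono_left {x x' y : ℝ} (hx : x ∈ Ioo 0 (Real.log 2)) (hx' : x' ∈ Ioo 0 (Real.log 2))
    (hy : y ∈ Ioo 0 (Real.log 2)) (h : x ≤ x') : f₂Slope x y ≤ f₂Slope x' y := by
  have := antitoneOn_artanh_mul_div_artanh (bias_mem_Ioo hy) (bias_mem_Ioo hx') (bias_mem_Ioo hx)
    (strictAntiOn_bias.antitoneOn (Ioo_subset_Icc_self hx) (Ioo_subset_Icc_self hx') h)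
  rw [f₂Slope, f₂Slope, mul_div_assoc, mul_div_assoc]
  exact mul_le_mul_of_nonneg_left this (bias_mem_Ioo hy).1.le

theorem f₂Slope_anti_right {x y y' : ℝ} (hx : x ∈ Ioo 0 (Real.log 2))
    (hy : y ∈ Ioo 0 (Real.log 2)) (hy' : y' ∈ Ioo 0 (Real.log 2)) (h : y ≤ y') :
    f₂Slope x y' ≤ f₂Slope x y := by
  have hu := bias_mem_Ioo hx
  have hv := bias_mem_Ioo hy
  have hv' := bias_mem_Ioo hy'
  have hvv : bias y' ≤ bias y :=
    strictAntiOn_bias.antitoneOn (Ioo_subset_Icc_self hy) (Ioo_subset_Icc_self hy') h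
  have huv := mul_mem_Ioo hu hv
  have huv' := mul_mem_Ioo hu hv'
  rw [f₂Slope, f₂Slope]
  refine div_le_div_of_nonneg_right ?_ (Real.artanh_pos hu).le
  exact mul_le_mul hvv (Real.artanh_le_artanh (by linarith [huv'.1]) huv.2
    (mul_le_mul_of_nonneg_left hvv hu.1.le)) (Real.artanh_pos huv').le hv.1.le

/-- Mrs. Gerber's lemma. The endpoints are treated separately since the formula for the slope
degenerates there. -/
theorem convexOn_f₂_left {y : ℝ} (hy : y ∈ Icc 0 (Real.log 2)) :
    ConvexOn ℝ (Icc 0 (Real.log 2)) (fun x => f₂ x y) := by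
  rcases eq_or_lt_of_le hy.1 with h0 | h0
  · subst h0
    exact (convexOn_id (convex_Icc 0 (Real.log 2))).congr fun x hx => (f₂_zero_right hx).symm
  rcases eq_or_lt_of_le hy.2 with h1 | h1
  · subst h1
    simp only [f₂_log_two_right]
    exact convexOn_const _ (convex_Icc _ _)
  refine MonotoneOn.convexOn_of_deriv (convex_Icc _ _) (continuousOn_f₂_left y) ?_ ?_ <;>
    rw [interior_Icc]
  · intro x hx
    exact (hasDerivAt_f₂_left hx hy).differentiableAt.differentiableWithinAt
  · intro a ha b hb hab
    rw [(hasDerivAt_f₂_left ha hy).deriv, (hasDerivAt_f₂_left hb hy).deriv]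
    exact f₂Slope_mono_left ha hb ⟨h0, h1⟩ hab

theorem convexOn_f₂_right {x : ℝ} (hx : x ∈ Icc 0 (Real.log 2)) :
    ConvexOn ℝ (Icc 0 (Real.log 2)) (fun y => f₂ x y) := by
  simpa only [f₂_comm x] using convexOn_f₂_left hx

/-! ### The partial derivative of `f₂` along rays -/

/-- The derivative of `f₂Slope` along a path with velocity `(α, β)`. -/
theorem hasDerivAt_f₂Slope_comp {X Y : ℝ → ℝ} {α β t : ℝ} (hX : HasDerivAt X α t)
    (hY : HasDerivAt Y β t) (hx : X t ∈ Ioo 0 (Real.log 2)) (hy : Y t ∈ Ioo 0 (Real.log 2)) :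
    HasDerivAt (fun t => f₂Slope (X t) (Y t))
      (-(f₂Slope (X t) (Y t) /
        (bias (X t) * Real.artanh (bias (X t)) * (bias (Y t) * Real.artanh (bias (Y t))))) *
        (β * (bias (X t) * Real.artanh (bias (X t))) *
            (1 + artanhElasticity (bias (X t) * bias (Y t)))
          + α * (bias (Y t) * Real.artanh (bias (Y t))) *
            (artanhElasticity (bias (X t) * bias (Y t)) - artanhElasticity (bias (X t))))) t := by
  have hu := bias_mem_Ioo hx
  have hv := bias_mem_Ioo hy
  have huv := mul_mem_Ioo hu hv
  have hU : HasDerivAt (fun t => bias (X t)) ((-Real.artanh (bias (X t)))⁻¹ * α) t :=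
    (hasDerivAt_bias hx).comp t hX
  have hV : HasDerivAt (fun t => bias (Y t)) ((-Real.artanh (bias (Y t)))⁻¹ * β) t :=
    (hasDerivAt_bias hy).comp t hY
  have hTu : HasDerivAt (fun t => Real.artanh (bias (X t)))
      (1 / (1 - bias (X t) ^ 2) * ((-Real.artanh (bias (X t)))⁻¹ * α)) t :=
    hasDerivAt_artanh_comp hU hu
  have hTuv : HasDerivAt (fun t => Real.artanh (bias (X t) * bias (Y t)))
      (1 / (1 - (bias (X t) * bias (Y t)) ^ 2) * ((-Real.artanh (bias (X t)))⁻¹ * α * bias (Y t)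
        + bias (X t) * ((-Real.artanh (bias (Y t)))⁻¹ * β))) t :=
    hasDerivAt_artanh_comp (hU.mul hV) huv
  have h := (hV.mul hTuv).div hTu (Real.artanh_pos hu).ne'
  refine h.congr_deriv ?_
  have h1 := (Real.artanh_pos hu).ne'
  have h2 := (Real.artanh_pos huv).ne'
  have h3 := (one_sub_sq_pos hu).ne'
  have h4 := (one_sub_sq_pos huv).ne'
  have h5 := (Real.artanh_pos hv).ne'
  have hu0 := hu.1.ne'
  have hv0 := hv.1.ne'
  simp only [f₂Slope, artanhElasticity, Pi.mul_apply]
  field_simp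
  ring

theorem f₂Slope_nonneg {x y : ℝ} (hx : x ∈ Ioo 0 (Real.log 2)) (hy : y ∈ Ioo 0 (Real.log 2)) :
    0 ≤ f₂Slope x y := by
  have hu := bias_mem_Ioo hx
  have hv := bias_mem_Ioo hy
  exact div_nonneg (mul_nonneg hv.1.le (Real.artanh_pos (mul_mem_Ioo hu hv)).le)
    (Real.artanh_pos hu).le

theorem f₂Slope_weight_nonneg {x y : ℝ} (hx : x ∈ Ioo 0 (Real.log 2))
    (hy : y ∈ Ioo 0 (Real.log 2)) :
    0 ≤ f₂Slope x y /
      (bias x * Real.artanh (bias x) * (bias y * Real.artanh (bias y))) := by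
  have hu := bias_mem_Ioo hx
  have hv := bias_mem_Ioo hy
  exact div_nonneg (f₂Slope_nonneg hx hy) (mul_nonneg (mul_nonneg hu.1.le (Real.artanh_pos hu).le)
    (mul_nonneg hv.1.le (Real.artanh_pos hv).le))

theorem mul_mem_Ioo_log_two {x c : ℝ} (hx : x ∈ Ioo 0 (Real.log 2)) (hc : c ∈ Ioc (0 : ℝ) 1) :
    c * x ∈ Ioo 0 (Real.log 2) :=
  ⟨mul_pos hc.1 hx.1, (mul_le_of_le_one_left hx.1.le hc.2).trans_lt hx.2⟩

theorem log_two_sub_mem_Ioo {x : ℝ} (hx : x ∈ Ioo 0 (Real.log 2)) :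
    Real.log 2 - x ∈ Ioo 0 (Real.log 2) :=
  ⟨sub_pos.2 hx.2, by linarith [hx.1]⟩

theorem log_two_sub_mem_Icc {x : ℝ} (hx : x ∈ Icc 0 (Real.log 2)) :
    Real.log 2 - x ∈ Icc 0 (Real.log 2) :=
  ⟨sub_nonneg.2 hx.2, by linarith [hx.1]⟩

/-- The partial derivative of `f₂` decreases along rays issuing from the origin. -/
theorem antitoneOn_f₂Slope_ray {x y : ℝ} (hx : x ∈ Ioo 0 (Real.log 2))
    (hy : y ∈ Ioo 0 (Real.log 2)) :
    AntitoneOn (fun c => f₂Slope (c * x) (c * y)) (Ioc 0 1) := by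
  have hd := fun c (hc : c ∈ Ioc (0 : ℝ) 1) => hasDerivAt_f₂Slope_comp
    (X := fun c => c * x) (Y := fun c => c * y) (α := x) (β := y)
    (by simpa using (hasDerivAt_id c).mul_const x) (by simpa using (hasDerivAt_id c).mul_const y)
    (mul_mem_Ioo_log_two hx hc) (mul_mem_Ioo_log_two hy hc)
  refine antitoneOn_of_hasDerivWithinAt_nonpos (convex_Ioc 0 1)
    (fun c hc => (hd c hc).continuousAt.continuousWithinAt)
    (fun c hc => (hd c (interior_subset hc)).hasDerivWithinAt) (fun c hc => ?_)
  have hc' := interior_subset hc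
  have hcx := mul_mem_Ioo_log_two hx hc'
  have hcy := mul_mem_Ioo_log_two hy hc'
  refine mul_nonpos_of_nonpos_of_nonneg (neg_nonpos.2 (f₂Slope_weight_nonneg hcx hcy)) ?_
  have h := elasticity_ineq_biasEntropy (bias_mem_Ioo hcx) (bias_mem_Ioo hcy)
  rw [biasEntropy_bias (Ioo_subset_Icc_self hcx), biasEntropy_bias (Ioo_subset_Icc_self hcy)] at h
  refine nonneg_of_mul_nonneg_right (a := c) ?_ hc'.1
  linarith

/-- The partial derivative of `f₂` increases along rays issuing from `(log 2, log 2)`, as long as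
the differentiated coordinate is the one closer to `log 2`. -/
theorem monotoneOn_f₂Slope_ray {x y : ℝ} (hx : x ∈ Ioo 0 (Real.log 2))
    (hy : y ∈ Ioo 0 (Real.log 2)) (hxy : x ≤ y) :
    MonotoneOn (fun c => f₂Slope (Real.log 2 - c * x) (Real.log 2 - c * y)) (Ioc 0 1) := by
  have hd := fun c (hc : c ∈ Ioc (0 : ℝ) 1) => hasDerivAt_f₂Slope_comp
    (X := fun c => Real.log 2 - c * x) (Y := fun c => Real.log 2 - c * y) (α := -x) (β := -y)
    (by simpa using ((hasDerivAt_id c).mul_const x).const_sub (Real.log 2))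
    (by simpa using ((hasDerivAt_id c).mul_const y).const_sub (Real.log 2))
    (log_two_sub_mem_Ioo (mul_mem_Ioo_log_two hx hc))
    (log_two_sub_mem_Ioo (mul_mem_Ioo_log_two hy hc))
  refine monotoneOn_of_hasDerivWithinAt_nonneg (convex_Ioc 0 1)
    (fun c hc => (hd c hc).continuousAt.continuousWithinAt)
    (fun c hc => (hd c (interior_subset hc)).hasDerivWithinAt) (fun c hc => ?_)
  have hc' := interior_subset hc
  have hcx := log_two_sub_mem_Ioo (mul_mem_Ioo_log_two hx hc')
  have hcy := log_two_sub_mem_Ioo (mul_mem_Ioo_log_two hy hc')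
  refine mul_nonneg_of_nonpos_of_nonpos (neg_nonpos.2 (f₂Slope_weight_nonneg hcx hcy)) ?_
  have h := elasticity_ineq_log_two_sub_biasEntropy (bias_mem_Ioo hcx) (bias_mem_Ioo hcy)
    (strictAntiOn_bias.antitoneOn (Ioo_subset_Icc_self hcy) (Ioo_subset_Icc_self hcx)
      (by nlinarith [hc'.1]))
  rw [biasEntropy_bias (Ioo_subset_Icc_self hcx), biasEntropy_bias (Ioo_subset_Icc_self hcy),
    sub_sub_cancel, sub_sub_cancel] at h
  by_contra hcon
  push Not at hcon
  have := mul_pos hc'.1 hcon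
  linarith

/-! ### Subadditivity of `f₂` -/

theorem continuousOn_f₂_comp {X Y : ℝ → ℝ} {D : Set ℝ} (hX : ContinuousOn X D)
    (hY : ContinuousOn Y D) (hXm : MapsTo X D (Icc 0 (Real.log 2)))
    (hYm : MapsTo Y D (Icc 0 (Real.log 2))) : ContinuousOn (fun t => f₂ (X t) (Y t)) D := by
  simp only [f₂_eq]
  exact continuous_biasEntropy.comp_continuousOn
    ((continuousOn_bias.comp hX hXm).mul (continuousOn_bias.comp hY hYm))

/-- The chain rule for `f₂` along a path with velocity `(α, β)`. -/
theorem hasDerivAt_f₂_comp {X Y : ℝ → ℝ} {α β t : ℝ} (hX : HasDerivAt X α t)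
    (hY : HasDerivAt Y β t) (hx : X t ∈ Ioo 0 (Real.log 2)) (hy : Y t ∈ Ioo 0 (Real.log 2)) :
    HasDerivAt (fun t => f₂ (X t) (Y t)) (f₂Slope (X t) (Y t) * α + f₂Slope (Y t) (X t) * β) t := by
  have hu := bias_mem_Ioo hx
  have hv := bias_mem_Ioo hy
  have huv := mul_mem_Ioo hu hv
  have hU : HasDerivAt (fun t => bias (X t)) ((-Real.artanh (bias (X t)))⁻¹ * α) t :=
    (hasDerivAt_bias hx).comp t hX
  have hV : HasDerivAt (fun t => bias (Y t)) ((-Real.artanh (bias (Y t)))⁻¹ * β) t :=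
    (hasDerivAt_bias hy).comp t hY
  have h : HasDerivAt (fun t => biasEntropy (bias (X t) * bias (Y t)))
      (-Real.artanh (bias (X t) * bias (Y t)) * ((-Real.artanh (bias (X t)))⁻¹ * α * bias (Y t)
        + bias (X t) * ((-Real.artanh (bias (Y t)))⁻¹ * β))) t :=
    hasDerivAt_biasEntropy_comp (hU.mul hV) huv
  simp only [f₂_eq]
  refine h.congr_deriv ?_
  have h1 := (Real.artanh_pos hu).ne'
  have h5 := (Real.artanh_pos hv).ne'
  rw [f₂Slope, f₂Slope, mul_comm (bias (Y t)) (bias (X t))]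
  field_simp
  ring

/-- `f₂` is concave along rays issuing from the origin, where it vanishes. -/
theorem mul_f₂_le_f₂_mul {x y c : ℝ} (hx : x ∈ Ioo 0 (Real.log 2))
    (hy : y ∈ Ioo 0 (Real.log 2)) (hc : c ∈ Icc (0 : ℝ) 1) :
    c * f₂ x y ≤ f₂ (c * x) (c * y) := by
  have hm : ∀ z ∈ Ioo 0 (Real.log 2), MapsTo (fun c => c * z) (Icc (0 : ℝ) 1)
      (Icc 0 (Real.log 2)) := fun z hz c hc =>
    ⟨mul_nonneg hc.1 hz.1.le, (mul_le_of_le_one_left hz.1.le hc.2).trans hz.2.le⟩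
  have hd := fun c (hc : c ∈ Ioo (0 : ℝ) 1) => hasDerivAt_f₂_comp
    (X := fun c => c * x) (Y := fun c => c * y) (α := x) (β := y)
    (by simpa using (hasDerivAt_id c).mul_const x) (by simpa using (hasDerivAt_id c).mul_const y)
    (mul_mem_Ioo_log_two hx (Ioo_subset_Ioc_self hc))
    (mul_mem_Ioo_log_two hy (Ioo_subset_Ioc_self hc))
  have hconc : ConcaveOn ℝ (Icc 0 1) (fun c => f₂ (c * x) (c * y)) := by
    refine AntitoneOn.concaveOn_of_deriv (convex_Icc 0 1) (continuousOn_f₂_comp (by fun_prop)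
      (by fun_prop) (hm x hx) (hm y hy)) ?_ ?_ <;> rw [interior_Icc]
    · intro c hc
      exact (hd c hc).differentiableAt.differentiableWithinAt
    · intro a ha b hb hab
      rw [(hd a ha).deriv, (hd b hb).deriv]
      exact add_le_add
        (mul_le_mul_of_nonneg_right (antitoneOn_f₂Slope_ray hx hy (Ioo_subset_Ioc_self ha)
          (Ioo_subset_Ioc_self hb) hab) hx.1.le)
        (mul_le_mul_of_nonneg_right (antitoneOn_f₂Slope_ray hy hx (Ioo_subset_Ioc_self ha)
          (Ioo_subset_Ioc_self hb) hab) hy.1.le)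
  have := hconc.2 (left_mem_Icc.2 zero_le_one) (right_mem_Icc.2 zero_le_one) (sub_nonneg.2 hc.2)
    hc.1 (sub_add_cancel 1 c)
  simpa [f₂_zero_left (left_mem_Icc.2 log_two_pos.le)] using this

/-- Subadditivity, for interior points the first of which has the smaller slope. The partial
derivative in `s` of the defect is nonnegative while `(s, t)` has the smaller slope, so `s` can be
decreased until the two points are collinear with the origin. -/
theorem f₂_add_le_of_slope_le {s t a b : ℝ} (ht : 0 < t) (ha : 0 < a) (hb : 0 < b)
    (hsa : s + a < Real.log 2) (htb : t + b < Real.log 2) (h : t * a ≤ b * s) :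
    f₂ (s + a) (t + b) ≤ f₂ s t + f₂ a b := by
  set s₀ := t * a / b with hs₀
  have hs₀0 : 0 < s₀ := by positivity
  have hs₀s : s₀ ≤ s := by rw [hs₀, div_le_iff₀ hb]; linarith
  have htI : t ∈ Ioo 0 (Real.log 2) := ⟨ht, by linarith⟩
  have htbI : t + b ∈ Ioo 0 (Real.log 2) := ⟨by linarith, htb⟩
  have hm : MonotoneOn (fun σ => f₂ σ t - f₂ (σ + a) (t + b)) (Icc s₀ s) := by
    have hI : ∀ σ ∈ Icc s₀ s, σ ∈ Ioo 0 (Real.log 2) ∧ σ + a ∈ Ioo 0 (Real.log 2) := fun σ hσ =>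
      ⟨⟨by linarith [hσ.1], by linarith [hσ.2]⟩, ⟨by linarith [hσ.1], by linarith [hσ.2]⟩⟩
    have hd : ∀ σ ∈ Icc s₀ s, HasDerivAt (fun σ => f₂ σ t - f₂ (σ + a) (t + b))
        (f₂Slope σ t - f₂Slope (σ + a) (t + b)) σ := fun σ hσ =>
      (hasDerivAt_f₂_left (hI σ hσ).1 (Ioo_subset_Icc_self htI)).sub
        ((hasDerivAt_f₂_left (hI σ hσ).2 (Ioo_subset_Icc_self htbI)).comp_add_const σ a)
    refine monotoneOn_of_hasDerivWithinAt_nonneg (convex_Icc _ _)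
      (fun σ hσ => (hd σ hσ).continuousAt.continuousWithinAt)
      (fun σ hσ => (hd σ (interior_subset hσ)).hasDerivWithinAt) (fun σ hσ => ?_)
    have hσ' := interior_subset hσ
    obtain ⟨h1, h2⟩ := hI σ hσ'
    -- The point of the ray through `(σ + a, t + b)` at height `t` lies left of `σ`.
    have hc : t / (t + b) ∈ Ioc (0 : ℝ) 1 :=
      ⟨by positivity, (div_le_one (by positivity)).2 (by linarith)⟩
    have hle : t / (t + b) * (σ + a) ≤ σ := by
      have := hσ'.1
      rw [hs₀, div_le_iff₀ hb] at this
      rw [div_mul_eq_mul_div, div_le_iff₀ (by positivity)]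
      linarith
    have e : t / (t + b) * (t + b) = t := div_mul_cancel₀ _ htbI.1.ne'
    have hray := antitoneOn_f₂Slope_ray h2 htbI hc (right_mem_Ioc.2 one_pos) hc.2
    have hmem := mul_mem_Ioo_log_two h2 hc
    simp only [one_mul, e] at hray
    exact sub_nonneg.2 (hray.trans (f₂Slope_mono_left hmem h1 htI hle))
  have h1 := hm (left_mem_Icc.2 hs₀s) (right_mem_Icc.2 hs₀s) hs₀s
  have hZ : s₀ + a ∈ Ioo 0 (Real.log 2) := ⟨by linarith, by linarith⟩
  have h2 := mul_f₂_le_f₂_mul hZ htbI (c := t / (t + b))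
    ⟨by positivity, (div_le_one (by positivity)).2 (by linarith)⟩
  have h3 := mul_f₂_le_f₂_mul hZ htbI (c := b / (t + b))
    ⟨by positivity, (div_le_one (by positivity)).2 (by linarith)⟩
  have htb0 := htbI.1.ne'
  rw [show t / (t + b) * (s₀ + a) = s₀ by rw [hs₀]; field_simp,
    show t / (t + b) * (t + b) = t by field_simp] at h2
  rw [show b / (t + b) * (s₀ + a) = a by rw [hs₀]; field_simp,
    show b / (t + b) * (t + b) = b by field_simp] at h3
  have h4 : t / (t + b) * f₂ (s₀ + a) (t + b) + b / (t + b) * f₂ (s₀ + a) (t + b)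
      = f₂ (s₀ + a) (t + b) := by
    field_simp
  simp only at h1
  linarith

theorem f₂_add_le {s t a b : ℝ} (hs : 0 ≤ s) (ht : 0 ≤ t) (ha : 0 ≤ a) (hb : 0 ≤ b)
    (hsa : s + a ≤ Real.log 2) (htb : t + b ≤ Real.log 2) :
    f₂ (s + a) (t + b) ≤ f₂ s t + f₂ a b := by
  have hsI : s ∈ Icc 0 (Real.log 2) := ⟨hs, by linarith⟩
  have htI : t ∈ Icc 0 (Real.log 2) := ⟨ht, by linarith⟩
  have haI : a ∈ Icc 0 (Real.log 2) := ⟨ha, by linarith⟩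
  have hbI : b ∈ Icc 0 (Real.log 2) := ⟨hb, by linarith⟩
  have hsaI : s + a ∈ Icc 0 (Real.log 2) := ⟨by linarith, hsa⟩
  have htbI : t + b ∈ Icc 0 (Real.log 2) := ⟨by linarith, htb⟩
  rcases eq_or_lt_of_le hsa with h | hsa'
  · rw [h, f₂_log_two_left, ← h]
    exact add_le_add (le_f₂_left hsI htI) (le_f₂_left haI hbI)
  rcases eq_or_lt_of_le htb with h | htb'
  · rw [h, f₂_log_two_right, ← h]
    exact add_le_add (le_f₂_right hsI htI) (le_f₂_right haI hbI)
  rcases eq_or_lt_of_le hs with rfl | hs'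
  · have := f₂_sub_le hbI htbI haI (by linarith)
    rw [f₂_zero_left htI, zero_add, f₂_comm a, f₂_comm a]
    linarith
  rcases eq_or_lt_of_le ht with rfl | ht'
  · have := f₂_sub_le haI hsaI hbI (by linarith)
    rw [f₂_zero_right hsI, zero_add]
    linarith
  rcases eq_or_lt_of_le ha with rfl | ha'
  · have := f₂_sub_le htI htbI hsI (by linarith)
    rw [f₂_zero_left hbI, add_zero, f₂_comm s, f₂_comm s]
    linarith
  rcases eq_or_lt_of_le hb with rfl | hb'
  · have := f₂_sub_le hsI hsaI htI (by linarith)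
    rw [f₂_zero_right haI, add_zero]
    linarith
  rcases le_total (t * a) (b * s) with h | h
  · exact f₂_add_le_of_slope_le ht' ha' hb' hsa' htb' h
  · have := f₂_add_le_of_slope_le hb' hs' ht' (by linarith) (by linarith)
      (by linarith : b * s ≤ t * a)
    rw [add_comm s, add_comm t]
    linarith

/-! ### Superadditivity of the reflection of `f₂` -/

/-- The reflection `(x, y) ↦ log 2 - f₂ (log 2 - x) (log 2 - y)` of `f₂`. -/
noncomputable def f₂Refl (x y : ℝ) : ℝ := Real.log 2 - f₂ (Real.log 2 - x) (Real.log 2 - y)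

theorem f₂Refl_comm (x y : ℝ) : f₂Refl x y = f₂Refl y x := by
  rw [f₂Refl, f₂Refl, f₂_comm]

theorem f₂Refl_zero_left (y : ℝ) : f₂Refl 0 y = 0 := by
  rw [f₂Refl, sub_zero, f₂_log_two_left, sub_self]

theorem f₂Refl_log_two_left {y : ℝ} (hy : y ∈ Icc 0 (Real.log 2)) :
    f₂Refl (Real.log 2) y = y := by
  rw [f₂Refl, sub_self, f₂_zero_left (log_two_sub_mem_Icc hy), sub_sub_cancel]

theorem f₂Refl_le_right {x y : ℝ} (hx : x ∈ Icc 0 (Real.log 2)) (hy : y ∈ Icc 0 (Real.log 2)) :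
    f₂Refl x y ≤ y := by
  have := le_f₂_right (log_two_sub_mem_Icc hx) (log_two_sub_mem_Icc hy)
  rw [f₂Refl]
  linarith

theorem f₂Refl_mono_left {x x' y : ℝ} (hx : x ∈ Icc 0 (Real.log 2))
    (hx' : x' ∈ Icc 0 (Real.log 2)) (hy : y ∈ Icc 0 (Real.log 2)) (h : x ≤ x') :
    f₂Refl x y ≤ f₂Refl x' y := by
  have := monotoneOn_f₂_left (log_two_sub_mem_Icc hy) (log_two_sub_mem_Icc hx')
    (log_two_sub_mem_Icc hx) (by linarith)
  simp only at this
  rw [f₂Refl, f₂Refl]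
  linarith

theorem hasDerivAt_f₂Refl_left {x y : ℝ} (hx : x ∈ Ioo 0 (Real.log 2))
    (hy : y ∈ Ioo 0 (Real.log 2)) :
    HasDerivAt (fun x => f₂Refl x y) (f₂Slope (Real.log 2 - x) (Real.log 2 - y)) x := by
  have h := ((hasDerivAt_f₂_left (log_two_sub_mem_Ioo hx)
    (Ioo_subset_Icc_self (log_two_sub_mem_Ioo hy))).comp_const_sub (Real.log 2) x).const_sub
    (Real.log 2)
  simpa [f₂Refl] using h

theorem hasDerivAt_f₂Refl_right {x y : ℝ} (hx : x ∈ Ioo 0 (Real.log 2))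
    (hy : y ∈ Ioo 0 (Real.log 2)) :
    HasDerivAt (fun y => f₂Refl x y) (f₂Slope (Real.log 2 - y) (Real.log 2 - x)) y := by
  simpa only [f₂Refl_comm x] using hasDerivAt_f₂Refl_left hy hx

/-- An equivalent form of `q (u * v) ≤ q u + q v` for
`q u = (log 2 - biasEntropy u) / (u * artanh u)`: the difference of the two sides, as a function of
`u ≤ v`, increases from its limit `0` at `u = 0`. -/
theorem log_two_sub_biasEntropy_mul_le {u v : ℝ} (hu : u ∈ Ioo (0 : ℝ) 1) (hv : v ∈ Ioo (0 : ℝ) 1)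
    (huv : u ≤ v) :
    Real.log 2 - biasEntropy (u * v) ≤
      (Real.log 2 - biasEntropy u) * v * (Real.artanh (u * v) / Real.artanh u)
        + (Real.log 2 - biasEntropy v) / Real.artanh v * (u * Real.artanh (u * v)) := by
  set E : ℝ → ℝ := fun u => (Real.log 2 - biasEntropy u) * v * (Real.artanh (u * v) / Real.artanh u)
    + (Real.log 2 - biasEntropy v) / Real.artanh v * (u * Real.artanh (u * v))
    - (Real.log 2 - biasEntropy (u * v)) with hE
  have hI : ∀ x ∈ Ioc 0 v, x ∈ Ioo (0 : ℝ) 1 := fun x hx => ⟨hx.1, hx.2.trans_lt hv.2⟩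
  have hd : ∀ x ∈ Ioc 0 v, HasDerivAt E
      (Real.artanh (x * v) / (x * Real.artanh x * Real.artanh v) *
        ((Real.log 2 - biasEntropy v) * (x * Real.artanh x) * (1 + artanhElasticity (x * v))
          + (Real.log 2 - biasEntropy x) * (v * Real.artanh v) *
            (artanhElasticity (x * v) - artanhElasticity x))) x := by
    intro x hx
    have hx' := hI x hx
    have hxv := mul_mem_Ioo hx' hv
    have hm : HasDerivAt (fun y : ℝ => y * v) v x := by
      simpa using (hasDerivAt_id x).mul_const v
    have hTm : HasDerivAt (fun y : ℝ => Real.artanh (y * v)) (1 / (1 - (x * v) ^ 2) * v) x :=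
      hasDerivAt_artanh_comp hm hxv
    have hkm : HasDerivAt (fun y : ℝ => biasEntropy (y * v)) (-Real.artanh (x * v) * v) x :=
      hasDerivAt_biasEntropy_comp hm hxv
    have hk := hasDerivAt_biasEntropy (u := x) ⟨by linarith [hx'.1], hx'.2⟩
    have h := (((hk.const_sub (Real.log 2)).mul_const v).mul
      (hasDerivAt_artanh_mul_div_artanh hx' hv)).add
      (((hasDerivAt_id x).mul hTm).const_mul ((Real.log 2 - biasEntropy v) / Real.artanh v))
    refine (h.sub (hkm.const_sub (Real.log 2))).congr_deriv ?_
    have h1 := (Real.artanh_pos hx').ne'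
    have h2 := (Real.artanh_pos hxv).ne'
    have h4 := (one_sub_sq_pos hxv).ne'
    have h5 := (Real.artanh_pos hv).ne'
    have hx0 := hx'.1.ne'
    have hv0 := hv.1.ne'
    have h6 := (one_sub_sq_pos hx').ne'
    simp only [artanhElasticity, id]
    generalize 1 - (x * v) ^ 2 = d at h4 ⊢
    generalize Real.artanh (x * v) = w at h2 ⊢
    field_simp
    ring
  have hm : MonotoneOn E (Ioc 0 v) := by
    refine monotoneOn_of_hasDerivWithinAt_nonneg (convex_Ioc _ _)
      (fun x hx => (hd x hx).continuousAt.continuousWithinAt)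
      (fun x hx => (hd x (interior_subset hx)).hasDerivWithinAt) (fun x hx => ?_)
    have hxc := interior_subset hx
    have hx' := hI x hxc
    refine mul_nonneg (div_nonneg (Real.artanh_pos (mul_mem_Ioo hx' hv)).le (mul_nonneg (mul_nonneg
      hx'.1.le (Real.artanh_pos hx').le) (Real.artanh_pos hv).le)) ?_
    have := elasticity_ineq_log_two_sub_biasEntropy hx' hv hxc.2
    linarith
  have hlim : Filter.Tendsto (fun w => -(Real.log 2 - biasEntropy (w * v)))
      (nhdsWithin 0 (Ioi 0)) (nhds 0) := by
    have hc : Continuous fun w => -(Real.log 2 - biasEntropy (w * v)) := by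
      have := continuous_biasEntropy
      fun_prop
    have := hc.tendsto 0
    simp only [zero_mul, biasEntropy_zero, sub_self, neg_zero] at this
    exact this.mono_left nhdsWithin_le_nhds
  have h0 : 0 ≤ E u := by
    refine le_of_tendsto hlim ?_
    filter_upwards [Ioo_mem_nhdsGT hu.1] with w hw
    have hwv : w ∈ Ioc 0 v := ⟨hw.1, by linarith [hw.2]⟩
    refine le_trans ?_ (hm hwv ⟨hu.1, huv⟩ hw.2.le)
    have hw' := hI w hwv
    have h1 := (Real.artanh_pos (mul_mem_Ioo hw' hv)).le
    have h2 := (Real.artanh_pos hw').le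
    have h3 := (Real.artanh_pos hv).le
    have h4 : 0 ≤ Real.log 2 - biasEntropy w := sub_nonneg.2 (biasEntropy_le w)
    have h5 : 0 ≤ Real.log 2 - biasEntropy v := sub_nonneg.2 (biasEntropy_le v)
    have h6 := hw'.1.le
    have h7 := hv.1.le
    have : 0 ≤ (Real.log 2 - biasEntropy w) * v * (Real.artanh (w * v) / Real.artanh w)
        + (Real.log 2 - biasEntropy v) / Real.artanh v * (w * Real.artanh (w * v)) := by
      positivity
    simp only [hE]
    linarith
  simp only [hE] at h0
  linarith

/-- Euler's differential inequality for `f₂Refl`, which says that `f₂Refl (c * x) (c * y) / c`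
increases with `c`. -/
theorem f₂Refl_le_euler {x y : ℝ} (hx : x ∈ Ioo 0 (Real.log 2)) (hy : y ∈ Ioo 0 (Real.log 2)) :
    f₂Refl x y ≤ f₂Slope (Real.log 2 - x) (Real.log 2 - y) * x
      + f₂Slope (Real.log 2 - y) (Real.log 2 - x) * y := by
  wlog hxy : y ≤ x generalizing x y
  · have := this hy hx (le_of_not_ge hxy)
    rw [f₂Refl_comm]
    linarith
  have hx' := log_two_sub_mem_Ioo hx
  have hy' := log_two_sub_mem_Ioo hy
  have h := log_two_sub_biasEntropy_mul_le (bias_mem_Ioo hy') (bias_mem_Ioo hx')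
    (strictAntiOn_bias.antitoneOn (Ioo_subset_Icc_self hx') (Ioo_subset_Icc_self hy')
      (by linarith))
  rw [biasEntropy_bias (Ioo_subset_Icc_self hx'), biasEntropy_bias (Ioo_subset_Icc_self hy'),
    sub_sub_cancel, sub_sub_cancel] at h
  rw [f₂Refl, f₂_eq, mul_comm (bias _)]
  refine h.trans_eq ?_
  rw [f₂Slope, f₂Slope, mul_comm (bias (Real.log 2 - x)) (bias (Real.log 2 - y))]
  ring

/-- `f₂Refl` is star-shaped. -/
theorem f₂Refl_mul_le {x y c : ℝ} (hx : x ∈ Ioo 0 (Real.log 2)) (hy : y ∈ Ioo 0 (Real.log 2))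
    (hc : c ∈ Ioc (0 : ℝ) 1) : f₂Refl (c * x) (c * y) ≤ c * f₂Refl x y := by
  have hd : ∀ c ∈ Ioc (0 : ℝ) 1, HasDerivAt (fun c => f₂Refl (c * x) (c * y) / c)
      ((f₂Slope (Real.log 2 - c * x) (Real.log 2 - c * y) * (c * x)
        + f₂Slope (Real.log 2 - c * y) (Real.log 2 - c * x) * (c * y) - f₂Refl (c * x) (c * y))
        / c ^ 2) c := by
    intro c hc
    have h := (hasDerivAt_f₂_comp
      (X := fun c => Real.log 2 - c * x) (Y := fun c => Real.log 2 - c * y) (α := -x) (β := -y)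
      (by simpa using ((hasDerivAt_id c).mul_const x).const_sub (Real.log 2))
      (by simpa using ((hasDerivAt_id c).mul_const y).const_sub (Real.log 2))
      (log_two_sub_mem_Ioo (mul_mem_Ioo_log_two hx hc))
      (log_two_sub_mem_Ioo (mul_mem_Ioo_log_two hy hc))).const_sub (Real.log 2)
    refine (h.div (hasDerivAt_id c) hc.1.ne').congr_deriv ?_
    simp only [id, f₂Refl]
    congr 1
    ring
  have hm : MonotoneOn (fun c => f₂Refl (c * x) (c * y) / c) (Ioc 0 1) := by
    refine monotoneOn_of_hasDerivWithinAt_nonneg (convex_Ioc _ _)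
      (fun c hc => (hd c hc).continuousAt.continuousWithinAt)
      (fun c hc => (hd c (interior_subset hc)).hasDerivWithinAt) (fun c hc => ?_)
    have hc' := interior_subset hc
    exact div_nonneg (sub_nonneg.2 (f₂Refl_le_euler (mul_mem_Ioo_log_two hx hc')
      (mul_mem_Ioo_log_two hy hc'))) (sq_nonneg c)
  have h := hm hc (right_mem_Ioc.2 one_pos) hc.2
  simp only [one_mul, div_one] at h
  rw [div_le_iff₀ hc.1] at h
  linarith

/-- Superadditivity, for interior points whose sum lies below the diagonal and of which the second
has the larger slope. The partial derivative in `b` of the defect is nonnegative while `(a, b)` has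
the larger slope, so `b` can be decreased until the two points are collinear with the origin. -/
theorem f₂Refl_add_ge_of_slope_le {s t a b : ℝ} (hs : 0 < s) (ht : 0 < t) (ha : 0 < a)
    (hsa : s + a < Real.log 2) (htb : t + b < Real.log 2) (h : t * a ≤ b * s)
    (hdiag : t + b ≤ s + a) :
    f₂Refl s t + f₂Refl a b ≤ f₂Refl (s + a) (t + b) := by
  set b₀ := t * a / s with hb₀
  have hb₀0 : 0 < b₀ := by positivity
  have hb₀b : b₀ ≤ b := by rw [hb₀, div_le_iff₀ hs]; exact h
  have haI : a ∈ Ioo 0 (Real.log 2) := ⟨ha, by linarith⟩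
  have hsaI : s + a ∈ Ioo 0 (Real.log 2) := ⟨by linarith, hsa⟩
  have hm : MonotoneOn (fun β => f₂Refl (s + a) (t + β) - f₂Refl a β) (Icc b₀ b) := by
    have hI : ∀ β ∈ Icc b₀ b, β ∈ Ioo 0 (Real.log 2) ∧ t + β ∈ Ioo 0 (Real.log 2) := fun β hβ =>
      ⟨⟨by linarith [hβ.1], by linarith [hβ.2]⟩, ⟨by linarith [hβ.1], by linarith [hβ.2]⟩⟩
    have hd : ∀ β ∈ Icc b₀ b, HasDerivAt (fun β => f₂Refl (s + a) (t + β) - f₂Refl a β)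
        (f₂Slope (Real.log 2 - (t + β)) (Real.log 2 - (s + a))
          - f₂Slope (Real.log 2 - β) (Real.log 2 - a)) β := fun β hβ =>
      ((hasDerivAt_f₂Refl_right hsaI (hI β hβ).2).comp_const_add t β).sub
        (hasDerivAt_f₂Refl_right haI (hI β hβ).1)
    refine monotoneOn_of_hasDerivWithinAt_nonneg (convex_Icc _ _)
      (fun β hβ => (hd β hβ).continuousAt.continuousWithinAt)
      (fun β hβ => (hd β (interior_subset hβ)).hasDerivWithinAt) (fun β hβ => ?_)
    have hβ' := interior_subset hβ
    obtain ⟨h1, h2⟩ := hI β hβ'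
    -- The ray through `(max a β, β)` stays below the diagonal, where the slope is monotone; it
    -- meets the height `t + β` at a point left of `s + a`.
    have hM : max a β ∈ Ioo 0 (Real.log 2) := ⟨lt_max_of_lt_left ha, max_lt haI.2 h1.2⟩
    set μ := (t + β) / β with hμ
    have hμ0 : 0 < μ := div_pos h2.1 h1.1
    have hμ1 : 1 ≤ μ := by rw [hμ, one_le_div h1.1]; linarith
    have hμβ : μ * β = t + β := div_mul_cancel₀ _ h1.1.ne'
    have hμM : μ * max a β ≤ s + a := by
      rcases max_choice a β with hc | hc <;> rw [hc]
      · have := hβ'.1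
        rw [hb₀, div_le_iff₀ hs] at this
        rw [hμ, div_mul_eq_mul_div, div_le_iff₀ h1.1]
        linarith
      · rw [hμβ]
        linarith [hβ'.2]
    have hμMI : μ * max a β ∈ Ioo 0 (Real.log 2) := ⟨mul_pos hμ0 hM.1, hμM.trans_lt hsa⟩
    have hray := monotoneOn_f₂Slope_ray h2 hμMI
      (by rw [← hμβ]; exact mul_le_mul_of_nonneg_left (le_max_right _ _) hμ0.le)
      (a := μ⁻¹) ⟨inv_pos.2 hμ0, inv_le_one_of_one_le₀ hμ1⟩ (right_mem_Ioc.2 one_pos)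
      (inv_le_one_of_one_le₀ hμ1)
    simp only [one_mul, inv_mul_cancel_left₀ hμ0.ne'] at hray
    rw [← hμβ, inv_mul_cancel_left₀ hμ0.ne', hμβ] at hray
    have hfirst := f₂Slope_anti_right (log_two_sub_mem_Ioo h1) (log_two_sub_mem_Ioo hM)
      (log_two_sub_mem_Ioo haI) (sub_le_sub_left (le_max_left a β) _)
    have hlast := f₂Slope_anti_right (log_two_sub_mem_Ioo h2) (log_two_sub_mem_Ioo hsaI)
      (log_two_sub_mem_Ioo hμMI) (sub_le_sub_left hμM _)
    linarith
  have h1 := hm (left_mem_Icc.2 hb₀b) (right_mem_Icc.2 hb₀b) hb₀b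
  have hZ : t + b₀ ∈ Ioo 0 (Real.log 2) := ⟨by linarith, by linarith⟩
  have h2 := f₂Refl_mul_le hsaI hZ (c := s / (s + a))
    ⟨by positivity, (div_le_one (by positivity)).2 (by linarith)⟩
  have h3 := f₂Refl_mul_le hsaI hZ (c := a / (s + a))
    ⟨by positivity, (div_le_one (by positivity)).2 (by linarith)⟩
  have hsa0 := hsaI.1.ne'
  rw [show s / (s + a) * (t + b₀) = t by rw [hb₀]; field_simp,
    show s / (s + a) * (s + a) = s by field_simp] at h2
  rw [show a / (s + a) * (t + b₀) = b₀ by rw [hb₀]; field_simp,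
    show a / (s + a) * (s + a) = a by field_simp] at h3
  have h4 : s / (s + a) * f₂Refl (s + a) (t + b₀) + a / (s + a) * f₂Refl (s + a) (t + b₀)
      = f₂Refl (s + a) (t + b₀) := by
    field_simp
  simp only at h1
  linarith

theorem f₂Refl_add_ge {s t a b : ℝ} (hs : 0 ≤ s) (ht : 0 ≤ t) (ha : 0 ≤ a) (hb : 0 ≤ b)
    (hsa : s + a ≤ Real.log 2) (htb : t + b ≤ Real.log 2) :
    f₂Refl s t + f₂Refl a b ≤ f₂Refl (s + a) (t + b) := by
  wlog hdiag : t + b ≤ s + a generalizing s t a b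
  · rw [f₂Refl_comm s, f₂Refl_comm a, f₂Refl_comm (s + a)]
    exact this ht hs hb ha htb hsa (le_of_not_ge hdiag)
  wlog hslope : t * a ≤ b * s generalizing s t a b
  · rw [add_comm s, add_comm t, add_comm (f₂Refl s t)]
    exact this ha hb hs ht (by linarith) (by linarith) (by linarith) (by linarith)
  have hsI : s ∈ Icc 0 (Real.log 2) := ⟨hs, by linarith⟩
  have htI : t ∈ Icc 0 (Real.log 2) := ⟨ht, by linarith⟩
  have haI : a ∈ Icc 0 (Real.log 2) := ⟨ha, by linarith⟩
  have hbI : b ∈ Icc 0 (Real.log 2) := ⟨hb, by linarith⟩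
  have hsaI : s + a ∈ Icc 0 (Real.log 2) := ⟨by linarith, hsa⟩
  have htbI : t + b ∈ Icc 0 (Real.log 2) := ⟨by linarith, htb⟩
  rcases eq_or_lt_of_le hsa with h | hsa'
  · rw [h, f₂Refl_log_two_left htbI]
    exact add_le_add (f₂Refl_le_right hsI htI) (f₂Refl_le_right haI hbI)
  rcases eq_or_lt_of_le hs with rfl | hs'
  · rw [f₂Refl_zero_left, zero_add, zero_add, f₂Refl_comm a, f₂Refl_comm a]
    exact f₂Refl_mono_left hbI htbI haI (by linarith)
  rcases eq_or_lt_of_le ht with rfl | ht'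
  · rw [f₂Refl_comm s, f₂Refl_zero_left, zero_add, zero_add]
    exact f₂Refl_mono_left haI hsaI hbI (by linarith)
  rcases eq_or_lt_of_le ha with rfl | ha'
  · rw [f₂Refl_zero_left, add_zero, add_zero, f₂Refl_comm s, f₂Refl_comm s]
    exact f₂Refl_mono_left htI htbI hsI (by linarith)
  rcases eq_or_lt_of_le hb with rfl | hb'
  · rw [f₂Refl_comm a, f₂Refl_zero_left, add_zero, add_zero]
    exact f₂Refl_mono_left hsI hsaI htI (by linarith)
  exact f₂Refl_add_ge_of_slope_le hs' ht' ha' hsa' (by linarith) hslope hdiag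

/-- The companion of `f₂_add_le` for sums beyond `log 2`. -/
theorem f₂_add_sub_le {s t a b : ℝ} (hs : s ≤ Real.log 2) (ht : t ≤ Real.log 2)
    (ha : a ≤ Real.log 2) (hb : b ≤ Real.log 2)
    (hsa : Real.log 2 ≤ s + a) (htb : Real.log 2 ≤ t + b) :
    f₂ (s + a - Real.log 2) (t + b - Real.log 2) + Real.log 2 ≤ f₂ s t + f₂ a b := by
  have h := f₂Refl_add_ge (sub_nonneg.2 hs) (sub_nonneg.2 ht) (sub_nonneg.2 ha) (sub_nonneg.2 hb)
    (by linarith) (by linarith)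
  simp only [f₂Refl, sub_sub_cancel] at h
  rw [show Real.log 2 - (Real.log 2 - s + (Real.log 2 - a)) = s + a - Real.log 2 by ring,
    show Real.log 2 - (Real.log 2 - t + (Real.log 2 - b)) = t + b - Real.log 2 by ring] at h
  linarith

/-! ### Double covers of finite abelian groups -/

/-- `π : G → K` is a surjective homomorphism with kernel `{0, τ}`, `τ ≠ 0`. The kernel condition is
stated on fibres. -/
structure IsDoubleCover {G K : Type*} [AddCommGroup G] [AddCommGroup K] (π : G →+ K) (τ : G) :
    Prop where
  ne_zero : τ ≠ 0
  surjective : Function.Surjective π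
  apply_eq_iff : ∀ g h, π g = π h ↔ h = g ∨ h = g + τ

namespace IsDoubleCover

variable {G K : Type*} [AddCommGroup G] [AddCommGroup K] {π : G →+ K} {τ : G}

theorem apply_add (hπ : IsDoubleCover π τ) (g : G) : π (g + τ) = π g :=
  ((hπ.apply_eq_iff g (g + τ)).2 (Or.inr rfl)).symm

theorem add_self (hπ : IsDoubleCover π τ) : τ + τ = 0 := by
  have h : π τ = π 0 := by simpa using hπ.apply_add 0
  rcases (hπ.apply_eq_iff τ 0).1 h with h | h
  · exact absurd h.symm hπ.ne_zero
  · exact h.symm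

theorem sum_fiber [Fintype G] [DecidableEq K] (hπ : IsDoubleCover π τ) (F : G → ℝ) (g : G) :
    ∑ h with π h = π g, F h = F g + F (g + τ) := by
  classical
  have : (Finset.univ.filter fun h => π h = π g) = {g, g + τ} := by
    ext h
    simp [eq_comm (a := π h), hπ.apply_eq_iff g h]
  rw [this, Finset.sum_pair]
  simpa using hπ.ne_zero

theorem sum_comp [Fintype G] [Fintype K] (hπ : IsDoubleCover π τ) (F : K → ℝ) :
    ∑ g, F (π g) = 2 * ∑ i, F i := by
  classical
  rw [← Finset.sum_fiberwise (s := Finset.univ) (g := π), Finset.mul_sum]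
  refine Finset.sum_congr rfl fun i _ => ?_
  obtain ⟨g, rfl⟩ := hπ.surjective i
  rw [hπ.sum_fiber, hπ.apply_add]
  ring

end IsDoubleCover

/-! ### Entropy along a double cover -/

section FiberEntropy

variable {G K : Type*} [AddCommGroup G] [Fintype G] [AddCommGroup K]

theorem sum_add_right (F : G → ℝ) (τ : G) : ∑ g, F (g + τ) = ∑ g, F g :=
  Equiv.sum_comp (Equiv.addRight τ) F

/-- The Shannon entropy of a real-valued weight function on a finite type. -/
noncomputable def weightEntropy {α : Type*} [Fintype α] (p : α → ℝ) : ℝ :=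
  ∑ g, Real.negMulLog (p g)

/-- `p` is the weight function of a probability distribution. -/
structure IsProbWeight {α : Type*} [Fintype α] (p : α → ℝ) : Prop where
  nonneg : ∀ g, 0 ≤ p g
  sum_eq_one : ∑ g, p g = 1

theorem IsProbWeight.le_one {α : Type*} [Fintype α] {p : α → ℝ} (hp : IsProbWeight p) (g : α) :
    p g ≤ 1 := by
  rw [← hp.sum_eq_one]
  exact Finset.single_le_sum (fun i _ => hp.nonneg i) (Finset.mem_univ g)

theorem IsProbWeight.weightEntropy_nonneg {α : Type*} [Fintype α] {p : α → ℝ}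
    (hp : IsProbWeight p) : 0 ≤ weightEntropy p :=
  Finset.sum_nonneg fun g _ => Real.negMulLog_nonneg (hp.nonneg g) (hp.le_one g)

/-- The additive convolution of two weight functions. -/
def addConv (p q : G → ℝ) (g : G) : ℝ := ∑ h, p h * q (g - h)

theorem addConv_comm (p q : G → ℝ) : addConv p q = addConv q p := by
  ext g
  rw [addConv, addConv, ← Equiv.sum_comp (Equiv.subLeft g)]
  refine Finset.sum_congr rfl fun h _ => ?_
  rw [Equiv.subLeft_apply, sub_sub_cancel, mul_comm]

theorem sum_sum_sub (F : G → G → ℝ) : ∑ g, ∑ h, F h (g - h) = ∑ h, ∑ j, F h j := by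
  rw [Finset.sum_comm]
  refine Finset.sum_congr rfl fun h _ => ?_
  exact Equiv.sum_comp (Equiv.subRight h) (F h)

theorem IsProbWeight.addConv {p q : G → ℝ} (hp : IsProbWeight p) (hq : IsProbWeight q) :
    IsProbWeight (addConv p q) where
  nonneg g := Finset.sum_nonneg fun h _ => mul_nonneg (hp.nonneg _) (hq.nonneg _)
  sum_eq_one := by
    simp only [_root_.addConv]
    rw [sum_sum_sub fun h j => p h * q j]
    simp only [← Finset.mul_sum, hq.sum_eq_one, mul_one, hp.sum_eq_one]

/-- The image of a weight function under `π`. -/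
noncomputable def pushWeight (π : G →+ K) (p : G → ℝ) (i : K) : ℝ :=
  open Classical in ∑ h with π h = i, p h

/-- The average over the fibres of `π` of the entropy of `p` conditioned on the fibre. It is written
as a sum over `G`, which counts each fibre twice; the conditional bias of `p` on the fibre of `g` is
`(p g - p (g + τ)) / pushWeight π p (π g)`, and a fibre of weight `0` contributes `0`. -/
noncomputable def fiberEntropy (π : G →+ K) (τ : G) (p : G → ℝ) : ℝ :=
  ∑ g, pushWeight π p (π g) / 2 *
    biasEntropy ((p g - p (g + τ)) / pushWeight π p (π g))

theorem negMulLog_add_negMulLog {a b : ℝ} (ha : 0 ≤ a) (hb : 0 ≤ b) :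
    Real.negMulLog a + Real.negMulLog b =
      Real.negMulLog (a + b) + (a + b) * biasEntropy ((a - b) / (a + b)) := by
  rcases eq_or_lt_of_le (add_nonneg ha hb) with h | h
  · have ha0 : a = 0 := by linarith
    have hb0 : b = 0 := by linarith
    simp [ha0, hb0]
  · have e1 : (1 - (a - b) / (a + b)) / 2 = b / (a + b) := by field_simp; ring
    have e2 : 1 - b / (a + b) = a / (a + b) := by field_simp; ring
    rw [biasEntropy, e1, Real.binEntropy_eq_negMulLog_add_negMulLog_one_sub, e2]
    have h1 := Real.negMulLog_mul (a + b) (a / (a + b))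
    have h2 := Real.negMulLog_mul (a + b) (b / (a + b))
    rw [mul_div_cancel₀ _ h.ne'] at h1 h2
    have h3 : a / (a + b) * Real.negMulLog (a + b) + b / (a + b) * Real.negMulLog (a + b)
        = Real.negMulLog (a + b) := by
      field_simp
    linarith

theorem pushWeight_nonneg {p : G → ℝ} (hp : IsProbWeight p) (π : G →+ K) (i : K) :
    0 ≤ pushWeight π p i :=
  Finset.sum_nonneg fun g _ => hp.nonneg g

theorem isProbWeight_pushWeight [Fintype K] {p : G → ℝ} (hp : IsProbWeight p) (π : G →+ K) :
    IsProbWeight (pushWeight π p) where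
  nonneg := pushWeight_nonneg hp π
  sum_eq_one := by
    classical
    rw [← hp.sum_eq_one, ← Finset.sum_fiberwise (s := Finset.univ) (g := π)]
    refine Finset.sum_congr rfl fun i _ => ?_
    rw [pushWeight]

namespace IsDoubleCover

variable {π : G →+ K} {τ : G}

theorem pushWeight_apply (hπ : IsDoubleCover π τ) (p : G → ℝ) (g : G) :
    pushWeight π p (π g) = p g + p (g + τ) := by
  classical
  rw [← hπ.sum_fiber p g, pushWeight]

theorem sum_pushWeight_div_two [Fintype K] (hπ : IsDoubleCover π τ) {p : G → ℝ}
    (hp : IsProbWeight p) :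
    ∑ g, pushWeight π p (π g) / 2 = 1 := by
  rw [hπ.sum_comp fun i => pushWeight π p i / 2, ← Finset.sum_div,
    (isProbWeight_pushWeight hp π).sum_eq_one]
  norm_num

/-- The chain rule for the entropy along `π`. -/
theorem weightEntropy_eq [Fintype K] (hπ : IsDoubleCover π τ) {p : G → ℝ} (hp : IsProbWeight p) :
    weightEntropy p = weightEntropy (pushWeight π p) + fiberEntropy π τ p := by
  have h1 : 2 * weightEntropy p = ∑ g, (Real.negMulLog (p g) + Real.negMulLog (p (g + τ))) := by
    rw [Finset.sum_add_distrib, sum_add_right (fun g => Real.negMulLog (p g)), weightEntropy]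
    ring
  have h2 : 2 * weightEntropy (pushWeight π p) = ∑ g, Real.negMulLog (pushWeight π p (π g)) :=
    (hπ.sum_comp fun i => Real.negMulLog (pushWeight π p i)).symm
  have h3 : 2 * fiberEntropy π τ p = ∑ g, pushWeight π p (π g) *
      biasEntropy ((p g - p (g + τ)) / pushWeight π p (π g)) := by
    rw [fiberEntropy, Finset.mul_sum]
    refine Finset.sum_congr rfl fun g _ => ?_
    ring
  have h4 : 2 * weightEntropy p = 2 * weightEntropy (pushWeight π p) + 2 * fiberEntropy π τ p := by
    rw [h1, h2, h3, ← Finset.sum_add_distrib]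
    refine Finset.sum_congr rfl fun g _ => ?_
    rw [negMulLog_add_negMulLog (hp.nonneg _) (hp.nonneg _), hπ.pushWeight_apply]
  linarith

theorem pushWeight_addConv_apply (hπ : IsDoubleCover π τ) (p q : G → ℝ) (g : G) :
    pushWeight π (addConv p q) (π g) =
      ∑ h, pushWeight π p (π h) / 2 * pushWeight π q (π (g - h)) := by
  have h1 : pushWeight π (addConv p q) (π g) = ∑ h, p h * pushWeight π q (π (g - h)) := by
    rw [hπ.pushWeight_apply, addConv, addConv, ← Finset.sum_add_distrib]
    refine Finset.sum_congr rfl fun h _ => ?_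
    rw [hπ.pushWeight_apply, ← mul_add, add_sub_right_comm]
  have h2 : ∑ h, p h * pushWeight π q (π (g - h)) =
      ∑ h, p (h + τ) * pushWeight π q (π (g - h)) := by
    rw [← sum_add_right _ τ]
    refine Finset.sum_congr rfl fun h _ => ?_
    rw [map_sub, hπ.apply_add, map_sub]
  have h3 : ∑ h, pushWeight π p (π h) / 2 * pushWeight π q (π (g - h)) =
      (∑ h, p h * pushWeight π q (π (g - h))
        + ∑ h, p (h + τ) * pushWeight π q (π (g - h))) / 2 := by
    rw [← Finset.sum_add_distrib, Finset.sum_div]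
    refine Finset.sum_congr rfl fun h _ => ?_
    rw [hπ.pushWeight_apply p]
    ring
  rw [h3, ← h2, h1]
  ring

theorem pushWeight_addConv [Fintype K] (hπ : IsDoubleCover π τ) (p q : G → ℝ) :
    pushWeight π (addConv p q) = addConv (pushWeight π p) (pushWeight π q) := by
  ext i
  obtain ⟨g, rfl⟩ := hπ.surjective i
  rw [hπ.pushWeight_addConv_apply, addConv]
  have := hπ.sum_comp fun i => pushWeight π p i / 2 * pushWeight π q (π g - i)
  simp only [map_sub]
  rw [this, Finset.mul_sum]
  refine Finset.sum_congr rfl fun i _ => ?_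
  ring

theorem addConv_sub_addConv (hπ : IsDoubleCover π τ) (p q : G → ℝ) (g : G) :
    addConv p q g - addConv p q (g + τ) =
      ∑ h, (p h - p (h + τ)) * (q (g - h) - q (g - h + τ)) / 2 := by
  have h1 : addConv p q g - addConv p q (g + τ) =
      ∑ h, p h * (q (g - h) - q (g - h + τ)) := by
    rw [addConv, addConv, ← Finset.sum_sub_distrib]
    refine Finset.sum_congr rfl fun h _ => ?_
    rw [← mul_sub, add_sub_right_comm]
  have h2 : ∑ h, p h * (q (g - h) - q (g - h + τ)) =
      ∑ h, -(p (h + τ) * (q (g - h) - q (g - h + τ))) := by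
    rw [← sum_add_right _ τ]
    refine Finset.sum_congr rfl fun h _ => ?_
    have e1 : g - (h + τ) = g - h + τ := by
      rw [← sub_sub, sub_eq_add_neg (g - h), neg_eq_of_add_eq_zero_left hπ.add_self]
    rw [e1, add_assoc, hπ.add_self, add_zero]
    ring
  have h3 : ∑ h, (p h - p (h + τ)) * (q (g - h) - q (g - h + τ)) / 2 =
      (∑ h, p h * (q (g - h) - q (g - h + τ))
        + ∑ h, -(p (h + τ) * (q (g - h) - q (g - h + τ)))) / 2 := by
    rw [← Finset.sum_add_distrib, Finset.sum_div]
    refine Finset.sum_congr rfl fun h _ => ?_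
    ring
  rw [h3, ← h2, h1]
  ring

end IsDoubleCover

theorem div_mem_Icc_of_abs_le {a b : ℝ} (h : |a| ≤ b) : a / b ∈ Icc (-1 : ℝ) 1 := by
  have hb : 0 ≤ b := (abs_nonneg a).trans h
  rw [mem_Icc, ← abs_le, abs_div, abs_of_nonneg hb]
  exact div_le_one_of_le₀ h hb

/-- Concavity of the perspective of `biasEntropy`. -/
theorem sum_mul_biasEntropy_div_le {ι : Type*} [Fintype ι] {w d : ι → ℝ} (h : ∀ i, |d i| ≤ w i) :
    ∑ i, w i * biasEntropy (d i / w i) ≤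
      (∑ i, w i) * biasEntropy ((∑ i, d i) / ∑ i, w i) := by
  have hw : ∀ i, 0 ≤ w i := fun i => (abs_nonneg _).trans (h i)
  rcases eq_or_lt_of_le (Finset.sum_nonneg fun i (_ : i ∈ Finset.univ) => hw i) with h0 | h0
  · have hz : ∀ i, w i = 0 := fun i =>
      (Finset.sum_eq_zero_iff_of_nonneg fun i _ => hw i).1 h0.symm i (Finset.mem_univ i)
    simp [hz]
  · have hJ := concaveOn_biasEntropy.le_map_sum (t := Finset.univ) (w := fun i => w i / ∑ j, w j)
      (p := fun i => d i / w i) (fun i _ => div_nonneg (hw i) h0.le)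
      (by rw [← Finset.sum_div, div_self h0.ne']) (fun i _ => div_mem_Icc_of_abs_le (h i))
    simp only [smul_eq_mul] at hJ
    have e1 : ∑ i, w i / (∑ j, w j) * (d i / w i) = (∑ i, d i) / ∑ i, w i := by
      rw [Finset.sum_div]
      refine Finset.sum_congr rfl fun i _ => ?_
      rcases eq_or_ne (w i) 0 with hi | hi
      · have : d i = 0 := abs_nonpos_iff.1 (hi ▸ h i)
        simp [this]
      · field_simp
    have e2 : ∑ i, w i / (∑ j, w j) * biasEntropy (d i / w i) =
        (∑ i, w i * biasEntropy (d i / w i)) / ∑ j, w j := by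
      rw [Finset.sum_div]
      refine Finset.sum_congr rfl fun i _ => ?_
      ring
    rw [e1, e2, div_le_iff₀ h0] at hJ
    linarith

theorem biasEntropy_mem_of_abs {a : ℝ} (ha : a ∈ Icc (-1 : ℝ) 1) :
    biasEntropy a ∈ Icc 0 (Real.log 2) :=
  ⟨biasEntropy_nonneg ha, biasEntropy_le a⟩

theorem biasEntropy_mul {a b : ℝ} (ha : a ∈ Icc (-1 : ℝ) 1) (hb : b ∈ Icc (-1 : ℝ) 1) :
    biasEntropy (a * b) = f₂ (biasEntropy a) (biasEntropy b) := by
  rw [f₂_eq, ← biasEntropy_abs a, ← biasEntropy_abs b, bias_biasEntropy ⟨abs_nonneg a, abs_le.2 ha⟩,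
    bias_biasEntropy ⟨abs_nonneg b, abs_le.2 hb⟩, ← abs_mul, biasEntropy_abs]

/-- Jensen's inequality for the separately convex function `f₂` and a product distribution. -/
theorem f₂_sum_le {ι κ : Type*} [Fintype ι] [Fintype κ] {w : ι → ℝ} {w' : κ → ℝ} {x : ι → ℝ}
    {y : κ → ℝ} (hw : ∀ i, 0 ≤ w i) (hw1 : ∑ i, w i = 1) (hw' : ∀ j, 0 ≤ w' j)
    (hw1' : ∑ j, w' j = 1) (hx : ∀ i, x i ∈ Icc 0 (Real.log 2))
    (hy : ∀ j, y j ∈ Icc 0 (Real.log 2)) :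
    f₂ (∑ i, w i * x i) (∑ j, w' j * y j) ≤ ∑ i, ∑ j, w i * w' j * f₂ (x i) (y j) := by
  have hY : ∑ j, w' j * y j ∈ Icc 0 (Real.log 2) :=
    (convex_Icc 0 (Real.log 2)).sum_mem (fun j _ => hw' j) hw1' (fun j _ => hy j)
  have h1 := (convexOn_f₂_left hY).map_sum_le (t := Finset.univ) (fun i _ => hw i) hw1
    (fun i _ => hx i)
  simp only [smul_eq_mul] at h1
  refine h1.trans (Finset.sum_le_sum fun i _ => ?_)
  have h2 := (convexOn_f₂_right (hx i)).map_sum_le (t := Finset.univ) (fun j _ => hw' j) hw1'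
    (fun j _ => hy j)
  simp only [smul_eq_mul] at h2
  refine (mul_le_mul_of_nonneg_left h2 (hw i)).trans_eq ?_
  rw [Finset.mul_sum]
  refine Finset.sum_congr rfl fun j _ => ?_
  ring

namespace IsDoubleCover

variable {π : G →+ K} {τ : G}

theorem abs_sub_le_pushWeight (hπ : IsDoubleCover π τ) {p : G → ℝ} (hp : IsProbWeight p) (g : G) :
    |p g - p (g + τ)| ≤ pushWeight π p (π g) := by
  rw [hπ.pushWeight_apply, abs_le]
  constructor <;> linarith [hp.nonneg g, hp.nonneg (g + τ)]

theorem fiberEntropy_mem [Fintype K] (hπ : IsDoubleCover π τ) {p : G → ℝ} (hp : IsProbWeight p) :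
    fiberEntropy π τ p ∈ Icc 0 (Real.log 2) :=
  (convex_Icc 0 (Real.log 2)).sum_mem
    (fun _ _ => div_nonneg (pushWeight_nonneg hp π _) zero_le_two) (hπ.sum_pushWeight_div_two hp)
    (fun g _ => biasEntropy_mem_of_abs (div_mem_Icc_of_abs_le (hπ.abs_sub_le_pushWeight hp g)))

theorem f₂_fiberEntropy_le [Fintype K] (hπ : IsDoubleCover π τ) {p q : G → ℝ}
    (hp : IsProbWeight p) (hq : IsProbWeight q) :
    f₂ (fiberEntropy π τ p) (fiberEntropy π τ q) ≤ fiberEntropy π τ (addConv p q) := by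
  have hJ := f₂_sum_le
    (w := fun g => pushWeight π p (π g) / 2) (w' := fun g => pushWeight π q (π g) / 2)
    (fun g => div_nonneg (pushWeight_nonneg hp π _) zero_le_two) (hπ.sum_pushWeight_div_two hp)
    (fun g => div_nonneg (pushWeight_nonneg hq π _) zero_le_two) (hπ.sum_pushWeight_div_two hq)
    (fun g => biasEntropy_mem_of_abs (div_mem_Icc_of_abs_le (hπ.abs_sub_le_pushWeight hp g)))
    (fun g => biasEntropy_mem_of_abs (div_mem_Icc_of_abs_le (hπ.abs_sub_le_pushWeight hq g)))
  rw [← sum_sum_sub] at hJ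
  refine hJ.trans (Finset.sum_le_sum fun g _ => ?_)
  have hP := sum_mul_biasEntropy_div_le
    (w := fun h => pushWeight π p (π h) / 2 * pushWeight π q (π (g - h)))
    (d := fun h => (p h - p (h + τ)) * (q (g - h) - q (g - h + τ)) / 2) (fun h => by
      rw [abs_div, abs_mul, abs_two]
      have := mul_le_mul (hπ.abs_sub_le_pushWeight hp h) (hπ.abs_sub_le_pushWeight hq (g - h))
        (abs_nonneg _) (pushWeight_nonneg hp π _)
      linarith)
  rw [← hπ.pushWeight_addConv_apply, ← hπ.addConv_sub_addConv] at hP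
  have e : ∀ h, pushWeight π p (π h) / 2 * (pushWeight π q (π (g - h)) / 2) *
      f₂ (biasEntropy ((p h - p (h + τ)) / pushWeight π p (π h)))
        (biasEntropy ((q (g - h) - q (g - h + τ)) / pushWeight π q (π (g - h)))) =
      pushWeight π p (π h) / 2 * pushWeight π q (π (g - h)) *
        biasEntropy ((p h - p (h + τ)) * (q (g - h) - q (g - h + τ)) / 2 /
          (pushWeight π p (π h) / 2 * pushWeight π q (π (g - h)))) / 2 := by
    intro h
    have e1 : ∀ a b c d : ℝ, a * b / 2 / (c / 2 * d) = a / c * (b / d) := fun a b c d => by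
      rw [div_mul_eq_mul_div, div_div_div_cancel_right₀ two_ne_zero, div_mul_div_comm]
    rw [← biasEntropy_mul (div_mem_Icc_of_abs_le (hπ.abs_sub_le_pushWeight hp h))
      (div_mem_Icc_of_abs_le (hπ.abs_sub_le_pushWeight hq (g - h))), e1]
    ring
  simp only [e]
  rw [← Finset.sum_div, div_mul_eq_mul_div]
  exact div_le_div_of_nonneg_right hP zero_le_two

/-- Conditioning on the fibres of `π` splits off an `f₂` term from the entropy of a sum. -/
theorem weightEntropy_addConv_ge [Fintype K] (hπ : IsDoubleCover π τ) {p q : G → ℝ}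
    (hp : IsProbWeight p) (hq : IsProbWeight q) :
    weightEntropy (addConv (pushWeight π p) (pushWeight π q))
      + f₂ (fiberEntropy π τ p) (fiberEntropy π τ q) ≤ weightEntropy (addConv p q) := by
  rw [hπ.weightEntropy_eq (hp.addConv hq), hπ.pushWeight_addConv]
  linarith [hπ.f₂_fiberEntropy_le hp hq]

end IsDoubleCover

end FiberEntropy

/-! ### The lower bound -/

theorem sub_mul_log_two_mem_Icc {k : ℕ} {x : ℝ}
    (hx : x ∈ Icc (k * Real.log 2) ((k + 1) * Real.log 2)) :
    x - k * Real.log 2 ∈ Icc 0 (Real.log 2) :=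
  ⟨by linarith [hx.1], by linarith [hx.2]⟩

/-- `z` is at least the claimed value of the minimal sum entropy at `(x, y)`, whichever case of its
definition applies. -/
def IsAboveMin (x y z : ℝ) : Prop :=
  max x y ≤ z ∧ ∀ k : ℕ, x ∈ Icc (k * Real.log 2) ((k + 1) * Real.log 2) →
    y ∈ Icc (k * Real.log 2) ((k + 1) * Real.log 2) →
    f₂ (x - k * Real.log 2) (y - k * Real.log 2) + k * Real.log 2 ≤ z

/-- `z` is the claimed value of the minimal sum entropy at `(x, y)`, according to some case of its
definition. -/
def IsMinValue (x y z : ℝ) : Prop :=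
  z = max x y ∨ ∃ k : ℕ, x ∈ Icc (k * Real.log 2) ((k + 1) * Real.log 2) ∧
    y ∈ Icc (k * Real.log 2) ((k + 1) * Real.log 2) ∧
    z = f₂ (x - k * Real.log 2) (y - k * Real.log 2) + k * Real.log 2

theorem IsMinValue.le {x y z z' : ℝ} (h : IsMinValue x y z) (h' : IsAboveMin x y z') : z ≤ z' := by
  rcases h with rfl | ⟨k, hx, hy, rfl⟩
  · exact h'.1
  · exact h'.2 k hx hy

/-- Adding a fibre contribution `(a, b) ∈ [0, log 2]²`, whose entropy cost is `f₂ a b`, preserves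
the lower bound: within a block this is subadditivity of `f₂`, and across a block boundary its
reflected form. -/
theorem IsAboveMin.add {u v w a b : ℝ} (h : IsAboveMin u v w) (hu : 0 ≤ u) (hv : 0 ≤ v)
    (ha : a ∈ Icc 0 (Real.log 2)) (hb : b ∈ Icc 0 (Real.log 2)) :
    IsAboveMin (u + a) (v + b) (w + f₂ a b) := by
  have hL := log_two_pos
  have huw := (le_max_left u v).trans h.1
  have hvw := (le_max_right u v).trans h.1
  refine ⟨max_le (add_le_add huw (le_f₂_left ha hb)) (add_le_add hvw (le_f₂_right ha hb)),
    fun k hx hy => ?_⟩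
  have mixed : ∀ {u v a b : ℝ}, u ≤ k * Real.log 2 → k * Real.log 2 ≤ v → v ≤ w →
      a ∈ Icc 0 (Real.log 2) → b ∈ Icc 0 (Real.log 2) →
      u + a ∈ Icc (k * Real.log 2) ((k + 1) * Real.log 2) →
      v + b ∈ Icc (k * Real.log 2) ((k + 1) * Real.log 2) →
      f₂ (u + a - k * Real.log 2) (v + b - k * Real.log 2) + k * Real.log 2 ≤ w + f₂ a b := by
    intro u v a b h1 h2 hvw ha hb hx hy
    have hx' := sub_mul_log_two_mem_Icc hx
    have hy' := sub_mul_log_two_mem_Icc hy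
    have m1 := monotoneOn_f₂_left hy' hx' ha (by linarith)
    have m2 := f₂_sub_le hb hy' ha (by linarith)
    simp only [f₂_comm _ a] at m1 m2
    linarith
  rcases le_total u (k * Real.log 2) with h1 | h1 <;>
    rcases le_total v (k * Real.log 2) with h2 | h2
  · cases k with
    | zero =>
      have hu0 : u = 0 := le_antisymm (by simpa using h1) hu
      have hv0 : v = 0 := le_antisymm (by simpa using h2) hv
      subst hu0 hv0
      simpa using huw
    | succ j =>
      push_cast at *
      have hu' : u ∈ Icc (j * Real.log 2) ((j + 1) * Real.log 2) :=
        ⟨by linarith [hx.1, ha.2], by linarith⟩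
      have hv' : v ∈ Icc (j * Real.log 2) ((j + 1) * Real.log 2) :=
        ⟨by linarith [hy.1, hb.2], by linarith⟩
      have h3 := f₂_add_sub_le (s := u - j * Real.log 2) (t := v - j * Real.log 2)
        (by linarith) (by linarith) ha.2 hb.2 (by linarith [hx.1]) (by linarith [hy.1])
      have h4 := h.2 j hu' hv'
      rw [show u - j * Real.log 2 + a - Real.log 2 = u + a - (j + 1) * Real.log 2 by ring,
        show v - j * Real.log 2 + b - Real.log 2 = v + b - (j + 1) * Real.log 2 by ring] at h3
      linarith
  · exact mixed h1 h2 hvw ha hb hx hy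
  · rw [f₂_comm, f₂_comm a]
    exact mixed h2 h1 huw hb ha hy hx
  · have hu' : u ∈ Icc (k * Real.log 2) ((k + 1) * Real.log 2) := ⟨h1, by linarith [hx.2, ha.1]⟩
    have hv' : v ∈ Icc (k * Real.log 2) ((k + 1) * Real.log 2) := ⟨h2, by linarith [hy.2, hb.1]⟩
    have h3 := f₂_add_le (s := u - k * Real.log 2) (t := v - k * Real.log 2)
      (by linarith) (by linarith) ha.1 hb.1 (by linarith [hx.2]) (by linarith [hy.2])
    have h4 := h.2 k hu' hv'
    rw [sub_add_eq_add_sub, sub_add_eq_add_sub] at h3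
    linarith

theorem isAboveMin_zero {z : ℝ} (hz : 0 ≤ z) : IsAboveMin 0 0 z := by
  refine ⟨by simpa using hz, fun k hx _ => ?_⟩
  have hk : (k : ℝ) * Real.log 2 = 0 := le_antisymm hx.1 (by have := log_two_pos; positivity)
  rw [hk, sub_zero, f₂_zero_right (left_mem_Icc.2 log_two_pos.le), zero_add]
  exact hz

theorem isDoubleCover_castHom (n : ℕ) :
    IsDoubleCover (ZMod.castHom (pow_dvd_pow 2 n.le_succ) (ZMod (2 ^ n))).toAddMonoidHom
      ((2 ^ n : ℕ) : ZMod (2 ^ (n + 1))) := by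
  have hlt : 2 ^ n < 2 ^ (n + 1) := Nat.pow_lt_pow_right one_lt_two n.lt_succ_self
  refine ⟨?_, ZMod.castHom_surjective (pow_dvd_pow 2 n.le_succ), fun g h => ?_⟩
  · rw [Ne, ZMod.natCast_eq_zero_iff]
    exact Nat.not_dvd_of_pos_of_lt (by positivity) hlt
  · have key : ∀ z : ZMod (2 ^ (n + 1)),
        ZMod.castHom (pow_dvd_pow 2 n.le_succ) (ZMod (2 ^ n)) z = 0 ↔
          z = 0 ∨ z = ((2 ^ n : ℕ) : ZMod (2 ^ (n + 1))) := by
      intro z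
      obtain ⟨m, hm, rfl⟩ : ∃ m : ℕ, m < 2 ^ (n + 1) ∧ (m : ZMod (2 ^ (n + 1))) = z :=
        ⟨z.val, z.val_lt, ZMod.natCast_zmod_val z⟩
      rw [map_natCast, ZMod.natCast_eq_zero_iff]
      constructor
      · rintro ⟨c, rfl⟩
        have hc : c < 2 := by
          rw [pow_succ] at hm
          exact lt_of_mul_lt_mul_left hm (by positivity)
        interval_cases c
        · simp
        · simp
      · rintro (h | h)
        · rw [ZMod.natCast_eq_zero_iff] at h
          exact (pow_dvd_pow 2 n.le_succ).trans h
        · rw [ZMod.natCast_eq_natCast_iff', Nat.mod_eq_of_lt hm, Nat.mod_eq_of_lt hlt] at h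
          rw [h]
    have := key (h - g)
    rw [map_sub, sub_eq_zero, sub_eq_zero, sub_eq_iff_eq_add', eq_comm] at this
    exact this

theorem weightEntropy_of_subsingleton {α : Type*} [Fintype α] [Subsingleton α] {p : α → ℝ}
    (hp : IsProbWeight p) : weightEntropy p = 0 := by
  have h : ∀ g, p g = 1 := fun g => by
    rw [← hp.sum_eq_one, Fintype.sum_subsingleton _ g]
  simp [weightEntropy, h]

theorem isAboveMin_weightEntropy (n : ℕ) {p q : ZMod (2 ^ n) → ℝ} (hp : IsProbWeight p)
    (hq : IsProbWeight q) :
    IsAboveMin (weightEntropy p) (weightEntropy q) (weightEntropy (addConv p q)) := by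
  induction n with
  | zero =>
    have : Subsingleton (ZMod (2 ^ 0)) := by rw [pow_zero]; infer_instance
    rw [weightEntropy_of_subsingleton hp, weightEntropy_of_subsingleton hq]
    exact isAboveMin_zero (hp.addConv hq).weightEntropy_nonneg
  | succ n ih =>
    have hπ := isDoubleCover_castHom n
    set π := (ZMod.castHom (pow_dvd_pow 2 n.le_succ) (ZMod (2 ^ n))).toAddMonoidHom
    have hp' := isProbWeight_pushWeight hp π
    have hq' := isProbWeight_pushWeight hq π
    have h := (ih hp' hq').add hp'.weightEntropy_nonneg hq'.weightEntropy_nonneg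
      (hπ.fiberEntropy_mem hp) (hπ.fiberEntropy_mem hq)
    rw [← hπ.weightEntropy_eq hp, ← hπ.weightEntropy_eq hq] at h
    have h' := hπ.weightEntropy_addConv_ge hp hq
    exact ⟨h.1.trans h', fun k hx hy => (h.2 k hx hy).trans h'⟩

/-! ### Attaining the lower bound -/

section Attained

variable {G K : Type*} [AddCommGroup G] [AddCommGroup K]

/-- The weight function that spreads `p` uniformly over the fibres of a double cover `π`. -/
noncomputable def liftWeight (π : G →+ K) (p : K → ℝ) (g : G) : ℝ := p (π g) / 2

/-- The weight function of a bit of bias `u` with values in `{0, τ}`. -/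
noncomputable def bitWeight (τ : G) (u : ℝ) (g : G) : ℝ :=
  open Classical in if g = 0 then (1 + u) / 2 else if g = τ then (1 - u) / 2 else 0

theorem bitWeight_zero (τ : G) (u : ℝ) : bitWeight τ u 0 = (1 + u) / 2 := by
  simp [bitWeight]

theorem bitWeight_self {τ : G} (hτ : τ ≠ 0) (u : ℝ) : bitWeight τ u τ = (1 - u) / 2 := by
  simp [bitWeight, hτ]

theorem bitWeight_of_ne {τ g : G} (h0 : g ≠ 0) (hτ : g ≠ τ) (u : ℝ) : bitWeight τ u g = 0 := by
  simp [bitWeight, h0, hτ]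

theorem sum_comp_bitWeight [Fintype G] {τ : G} (hτ : τ ≠ 0) (u : ℝ) (F : G → ℝ → ℝ)
    (hF : ∀ g, F g 0 = 0) :
    ∑ g, F g (bitWeight τ u g) = F 0 ((1 + u) / 2) + F τ ((1 - u) / 2) := by
  rw [Fintype.sum_eq_add 0 τ hτ.symm, bitWeight_zero, bitWeight_self hτ]
  rintro g ⟨h0, h1⟩
  rw [bitWeight_of_ne h0 h1, hF]

theorem isProbWeight_bitWeight [Fintype G] {τ : G} (hτ : τ ≠ 0) {u : ℝ} (hu : u ∈ Icc (0 : ℝ) 1) :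
    IsProbWeight (bitWeight τ u) where
  nonneg g := by
    unfold bitWeight
    split_ifs <;> linarith [hu.1, hu.2]
  sum_eq_one := by
    rw [sum_comp_bitWeight hτ u (fun _ t => t) fun _ => rfl]
    ring

theorem weightEntropy_bitWeight [Fintype G] {τ : G} (hτ : τ ≠ 0) (u : ℝ) :
    weightEntropy (bitWeight τ u) = biasEntropy u := by
  rw [weightEntropy, sum_comp_bitWeight hτ u (fun _ t => Real.negMulLog t) fun _ => by simp,
    biasEntropy, Real.binEntropy_eq_negMulLog_add_negMulLog_one_sub, add_comm]
  congr 2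
  ring

theorem addConv_bitWeight_apply [Fintype G] {τ : G} (hτ : τ ≠ 0) (u : ℝ) (q : G → ℝ) (g : G) :
    addConv (bitWeight τ u) q g = (1 + u) / 2 * q g + (1 - u) / 2 * q (g - τ) := by
  rw [addConv, sum_comp_bitWeight hτ u (fun h t => t * q (g - h)) fun _ => zero_mul _, sub_zero]

namespace IsDoubleCover

variable {π : G →+ K} {τ : G}

theorem addConv_bitWeight_bitWeight [Fintype G] (hπ : IsDoubleCover π τ) (u v : ℝ) :
    addConv (bitWeight τ u) (bitWeight τ v) = bitWeight τ (u * v) := by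
  have hneg : -τ = τ := neg_eq_of_add_eq_zero_left hπ.add_self
  ext g
  rw [addConv_bitWeight_apply hπ.ne_zero]
  by_cases h0 : g = 0
  · subst h0
    rw [zero_sub, hneg, bitWeight_zero, bitWeight_zero, bitWeight_self hπ.ne_zero]
    ring
  by_cases h1 : g = τ
  · subst h1
    rw [sub_self, bitWeight_zero, bitWeight_self hπ.ne_zero, bitWeight_self hπ.ne_zero]
    ring
  rw [bitWeight_of_ne h0 h1, bitWeight_of_ne h0 h1, bitWeight_of_ne (sub_ne_zero.2 h1), mul_zero,
    mul_zero, add_zero]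
  intro h
  rw [sub_eq_iff_eq_add, hπ.add_self] at h
  exact h0 h

theorem addConv_bitWeight_liftWeight [Fintype G] (hπ : IsDoubleCover π τ) (u : ℝ) (q : K → ℝ) :
    addConv (bitWeight τ u) (liftWeight π q) = liftWeight π q := by
  ext g
  rw [addConv_bitWeight_apply hπ.ne_zero, liftWeight, liftWeight, ← hπ.apply_add (g - τ),
    sub_add_cancel]
  ring

variable [Fintype G] [Fintype K]

theorem isProbWeight_liftWeight (hπ : IsDoubleCover π τ) {p : K → ℝ} (hp : IsProbWeight p) :
    IsProbWeight (liftWeight π p) where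
  nonneg g := div_nonneg (hp.nonneg _) zero_le_two
  sum_eq_one := by
    have := hπ.sum_comp fun i => p i / 2
    simp only [liftWeight]
    rw [this, ← Finset.sum_div, hp.sum_eq_one]
    norm_num

theorem weightEntropy_liftWeight (hπ : IsDoubleCover π τ) {p : K → ℝ} (hp : IsProbWeight p) :
    weightEntropy (liftWeight π p) = weightEntropy p + Real.log 2 := by
  have h := hπ.sum_comp fun i => Real.negMulLog (p i / 2)
  have e : ∀ i, Real.negMulLog (p i / 2) = Real.negMulLog (p i) / 2 + p i * (Real.log 2 / 2) := by
    intro i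
    rw [div_eq_mul_inv, Real.negMulLog_mul, Real.negMulLog, Real.negMulLog, Real.log_inv]
    ring
  rw [weightEntropy, weightEntropy]
  simp only [liftWeight]
  rw [h]
  simp only [e]
  rw [Finset.sum_add_distrib, ← Finset.sum_div, ← Finset.sum_mul, hp.sum_eq_one]
  ring

theorem addConv_liftWeight_liftWeight (hπ : IsDoubleCover π τ) (p q : K → ℝ) :
    addConv (liftWeight π p) (liftWeight π q) = liftWeight π (addConv p q) := by
  ext g
  have h := hπ.sum_comp fun i => p i / 2 * (q (π g - i) / 2)
  simp only [addConv, liftWeight, map_sub]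
  rw [h, Finset.mul_sum, Finset.sum_div]
  refine Finset.sum_congr rfl fun i _ => ?_
  ring

end IsDoubleCover

end Attained

theorem IsMinValue.add_log_two {x y z : ℝ} (h : IsMinValue x y z) :
    IsMinValue (x + Real.log 2) (y + Real.log 2) (z + Real.log 2) := by
  rcases h with rfl | ⟨k, hx, hy, rfl⟩
  · exact Or.inl (max_add_add_right _ _ _).symm
  · refine Or.inr ⟨k + 1, ?_, ?_, ?_⟩
    · push_cast
      exact ⟨by linarith [hx.1], by linarith [hx.2]⟩
    · push_cast
      exact ⟨by linarith [hy.1], by linarith [hy.2]⟩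
    · push_cast
      rw [show x + Real.log 2 - (k + 1) * Real.log 2 = x - k * Real.log 2 by ring,
        show y + Real.log 2 - (k + 1) * Real.log 2 = y - k * Real.log 2 by ring]
      ring

/-- The induction distinguishes which of `x`, `y` are at most `log 2`: such an entropy is realized
by a bit with values in the kernel of the projection, a larger one by a spread-out distribution. -/
theorem exists_isMinValue_weightEntropy (n : ℕ) {x y : ℝ} (hx : x ∈ Icc 0 (n * Real.log 2))
    (hy : y ∈ Icc 0 (n * Real.log 2)) :
    ∃ p q : ZMod (2 ^ n) → ℝ, IsProbWeight p ∧ IsProbWeight q ∧ weightEntropy p = x ∧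
      weightEntropy q = y ∧ IsMinValue x y (weightEntropy (addConv p q)) := by
  induction n generalizing x y with
  | zero =>
    have : Subsingleton (ZMod (2 ^ 0)) := by rw [pow_zero]; infer_instance
    have hx0 : x = 0 := by simpa using hx
    have hy0 : y = 0 := by simpa using hy
    have h1 : IsProbWeight (fun _ : ZMod (2 ^ 0) => (1 : ℝ)) :=
      ⟨fun _ => zero_le_one, Fintype.sum_subsingleton _ 0⟩
    refine ⟨_, _, h1, h1, ?_, ?_, Or.inl ?_⟩
    · rw [hx0, weightEntropy_of_subsingleton h1]
    · rw [hy0, weightEntropy_of_subsingleton h1]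
    · rw [hx0, hy0, weightEntropy_of_subsingleton (h1.addConv h1), max_self]
  | succ n ih =>
    have hπ := isDoubleCover_castHom n
    set π := (ZMod.castHom (pow_dvd_pow 2 n.le_succ) (ZMod (2 ^ n))).toAddMonoidHom
    set τ := ((2 ^ n : ℕ) : ZMod (2 ^ (n + 1)))
    push_cast at hx hy
    have bit : ∀ {t : ℝ}, t ∈ Icc 0 (Real.log 2) → IsProbWeight (bitWeight τ (bias t)) ∧
        weightEntropy (bitWeight τ (bias t)) = t := fun ht =>
      ⟨isProbWeight_bitWeight hπ.ne_zero (bias_mem ht), by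
        rw [weightEntropy_bitWeight hπ.ne_zero, biasEntropy_bias ht]⟩
    have mixed : ∀ {x y : ℝ}, x ∈ Icc 0 (Real.log 2) → Real.log 2 ≤ y → y ≤ (n + 1) * Real.log 2 →
        ∃ p q : ZMod (2 ^ (n + 1)) → ℝ, IsProbWeight p ∧ IsProbWeight q ∧ weightEntropy p = x ∧
          weightEntropy q = y ∧ weightEntropy (addConv p q) = max x y := by
      intro x y hx hy1 hy2
      have hy' : y - Real.log 2 ∈ Icc 0 (n * Real.log 2) := ⟨by linarith, by linarith⟩
      obtain ⟨q, -, hq, -, hqe, -, -⟩ := ih hy' hy'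
      have hlift : weightEntropy (liftWeight π q) = y := by
        rw [hπ.weightEntropy_liftWeight hq, hqe, sub_add_cancel]
      refine ⟨bitWeight τ (bias x), liftWeight π q, (bit hx).1, hπ.isProbWeight_liftWeight hq,
        (bit hx).2, hlift, ?_⟩
      rw [hπ.addConv_bitWeight_liftWeight, hlift, max_eq_right (hx.2.trans hy1)]
    rcases le_total x (Real.log 2) with h1 | h1 <;> rcases le_total y (Real.log 2) with h2 | h2
    · have hx' : x ∈ Icc 0 (Real.log 2) := ⟨hx.1, h1⟩
      have hy' : y ∈ Icc 0 (Real.log 2) := ⟨hy.1, h2⟩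
      refine ⟨_, _, (bit hx').1, (bit hy').1, (bit hx').2, (bit hy').2, Or.inr ⟨0, ?_, ?_, ?_⟩⟩
      · simpa using hx'
      · simpa using hy'
      · rw [hπ.addConv_bitWeight_bitWeight, weightEntropy_bitWeight hπ.ne_zero, ← f₂_eq]
        simp
    · obtain ⟨p, q, hp, hq, hpe, hqe, he⟩ := mixed ⟨hx.1, h1⟩ h2 hy.2
      exact ⟨p, q, hp, hq, hpe, hqe, Or.inl he⟩
    · obtain ⟨p, q, hp, hq, hpe, hqe, he⟩ := mixed ⟨hy.1, h2⟩ h1 hx.2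
      exact ⟨q, p, hq, hp, hqe, hpe, Or.inl (by rw [addConv_comm, he, max_comm])⟩
    · obtain ⟨p, q, hp, hq, hpe, hqe, he⟩ := ih (x := x - Real.log 2) (y := y - Real.log 2)
        ⟨by linarith, by linarith [hx.2]⟩ ⟨by linarith, by linarith [hy.2]⟩
      refine ⟨liftWeight π p, liftWeight π q, hπ.isProbWeight_liftWeight hp,
        hπ.isProbWeight_liftWeight hq, ?_, ?_, ?_⟩
      · rw [hπ.weightEntropy_liftWeight hp, hpe, sub_add_cancel]
      · rw [hπ.weightEntropy_liftWeight hq, hqe, sub_add_cancel]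
      · rw [hπ.addConv_liftWeight_liftWeight, hπ.weightEntropy_liftWeight (hp.addConv hq)]
        simpa using he.add_log_two

/-! ### Random variables and their laws -/

theorem isProbWeight_law {Ω α : Type*} [MeasurableSpace Ω] [Fintype α] [MeasurableSpace α]
    [MeasurableSingletonClass α] (μ : Measure Ω) [IsProbabilityMeasure μ] {X : Ω → α}
    (hX : Measurable X) : IsProbWeight fun g => μ.real (X ⁻¹' {g}) where
  nonneg _ := measureReal_nonneg
  sum_eq_one := by
    rw [← measureReal_biUnion_finset]
    · rw [show (⋃ g ∈ Finset.univ, X ⁻¹' {g}) = Set.univ by ext ω; simp, probReal_univ]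
    · intro a _ b _ hab
      exact (disjoint_singleton.2 hab).preimage X
    · exact fun g _ => hX (measurableSet_singleton g)

theorem law_add_eq_addConv {Ω G : Type*} [MeasurableSpace Ω] [AddCommGroup G] [Fintype G]
    [MeasurableSpace G] [MeasurableSingletonClass G] (μ : Measure Ω) [IsProbabilityMeasure μ]
    {X Y : Ω → G} (hX : Measurable X) (hY : Measurable Y) (hXY : IndepFun X Y μ) :
    (fun g => μ.real ((fun ω => X ω + Y ω) ⁻¹' {g})) =
      addConv (fun g => μ.real (X ⁻¹' {g})) (fun g => μ.real (Y ⁻¹' {g})) := by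
  ext g
  have hU : (fun ω => X ω + Y ω) ⁻¹' {g} =
      ⋃ h ∈ (Finset.univ : Finset G), X ⁻¹' {h} ∩ Y ⁻¹' {g - h} := by
    ext ω
    simp [eq_sub_iff_add_eq, add_comm]
  rw [hU, measureReal_biUnion_finset, addConv]
  · refine Finset.sum_congr rfl fun h _ => ?_
    rw [measureReal_def, hXY.measure_inter_preimage_eq_mul _ _ (measurableSet_singleton _)
      (measurableSet_singleton _), ENNReal.toReal_mul, measureReal_def, measureReal_def]
  · intro a _ b _ hab
    exact ((disjoint_singleton.2 hab).preimage X).mono inter_subset_left inter_subset_left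
  · exact fun h _ => (hX (measurableSet_singleton h)).inter (hY (measurableSet_singleton _))

/-- Every probability weight function is the law of the projection `ULift α → α` under some
probability measure; the universe lift meets the universe required of the sample space. -/
theorem exists_measure_law {α : Type} [Fintype α] [MeasurableSpace α] [MeasurableSingletonClass α]
    {p : α → ℝ} (hp : IsProbWeight p) :
    ∃ μ : Measure (ULift.{u} α), IsProbabilityMeasure μ ∧
      ∀ g, μ.real (ULift.down ⁻¹' {g}) = p g := by
  classical
  set μ : Measure (ULift.{u} α) := ∑ g, ENNReal.ofReal (p g) • Measure.dirac (ULift.up g) with hμ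
  have hs : ∀ s : Set (ULift.{u} α), MeasurableSet s →
      μ s = ∑ g, ENNReal.ofReal (p g) * s.indicator 1 (ULift.up g) := by
    intro s hms
    simp [hμ, Measure.dirac_apply' _ hms]
  refine ⟨μ, ⟨?_⟩, fun g => ?_⟩
  · rw [hs _ MeasurableSet.univ]
    simp only [indicator_univ, Pi.one_apply, mul_one]
    rw [← ENNReal.ofReal_sum_of_nonneg fun g _ => hp.nonneg g, hp.sum_eq_one, ENNReal.ofReal_one]
  · rw [measureReal_def, hs _ (measurable_down (measurableSet_singleton g)),
      Finset.sum_eq_single g]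
    · simp [hp.nonneg g]
    · intro b _ hb
      simp [hb]
    · simp

/-- Passage from random variables to weight functions. Conversely, independent variables with given
laws are realized as the coordinates of a product space. -/
theorem mem_sumEntropies_iff {G : Type} [AddCommGroup G] [Fintype G] [MeasurableSpace G]
    [MeasurableSingletonClass G] {x y z : ℝ} :
    z ∈ sumEntropies.{u} G x y ↔ ∃ p q : G → ℝ, IsProbWeight p ∧ IsProbWeight q ∧
      weightEntropy p = x ∧ weightEntropy q = y ∧ weightEntropy (addConv p q) = z := by
  constructor
  · rintro ⟨Ω, _, μ, X, Y, _, hX, hY, hXY, hx, hy, hz⟩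
    refine ⟨_, _, isProbWeight_law μ hX, isProbWeight_law μ hY, hx, hy, ?_⟩
    rw [← law_add_eq_addConv μ hX hY hXY]
    exact hz
  · rintro ⟨p, q, hp, hq, hx, hy, hz⟩
    obtain ⟨μ, hμ, hμp⟩ := exists_measure_law.{u} hp
    obtain ⟨ν, hν, hνq⟩ := exists_measure_law.{u} hq
    have hX : Measurable fun ω : ULift.{u} G × ULift.{u} G => ω.1.down :=
      measurable_down.comp measurable_fst
    have hY : Measurable fun ω : ULift.{u} G × ULift.{u} G => ω.2.down :=
      measurable_down.comp measurable_snd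
    have hXY : IndepFun (fun ω : ULift.{u} G × ULift.{u} G => ω.1.down) (fun ω => ω.2.down)
        (μ.prod ν) := indepFun_prod measurable_down measurable_down
    have hXp : (fun g => (μ.prod ν).real
        ((fun ω : ULift.{u} G × ULift.{u} G => ω.1.down) ⁻¹' {g})) = p := by
      ext g
      rw [← hμp g]
      exact measurePreserving_fst.measureReal_preimage
        (measurable_down (measurableSet_singleton g)).nullMeasurableSet
    have hYq : (fun g => (μ.prod ν).real
        ((fun ω : ULift.{u} G × ULift.{u} G => ω.2.down) ⁻¹' {g})) = q := by
      ext g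
      rw [← hνq g]
      exact measurePreserving_snd.measureReal_preimage
        (measurable_down (measurableSet_singleton g)).nullMeasurableSet
    refine ⟨_, inferInstance, μ.prod ν, fun ω => ω.1.down, fun ω => ω.2.down, inferInstance,
      hX, hY, hXY, ?_, ?_, ?_⟩
    · rw [← hx, ← hXp]
      rfl
    · rw [← hy, ← hYq]
      rfl
    · rw [← hz, ← hXp, ← hYq, ← law_add_eq_addConv _ hX hY hXY]
      rfl

/-- Two blocks share at most their common corner, where both formulas give its coordinate. -/
theorem f₂_block_eq_of_lt {x y : ℝ} {j k : ℕ} (hjk : j < k)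
    (hxj : x ∈ Icc (j * Real.log 2) ((j + 1) * Real.log 2))
    (hyj : y ∈ Icc (j * Real.log 2) ((j + 1) * Real.log 2))
    (hxk : x ∈ Icc (k * Real.log 2) ((k + 1) * Real.log 2))
    (hyk : y ∈ Icc (k * Real.log 2) ((k + 1) * Real.log 2)) :
    f₂ (x - j * Real.log 2) (y - j * Real.log 2) + j * Real.log 2 =
      f₂ (x - k * Real.log 2) (y - k * Real.log 2) + k * Real.log 2 := by
  have hL := log_two_pos
  have hle : ((j : ℝ) + 1) * Real.log 2 ≤ k * Real.log 2 :=
    mul_le_mul_of_nonneg_right (by exact_mod_cast hjk) hL.le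
  have hk : k * Real.log 2 = (j + 1) * Real.log 2 := by linarith [hxj.2, hxk.1]
  have hx : x = (j + 1) * Real.log 2 := by linarith [hxj.2, hxk.1]
  have hy : y = (j + 1) * Real.log 2 := by linarith [hyj.2, hyk.1]
  rw [hk, hx, hy, sub_self, f₂_zero_left (left_mem_Icc.2 hL.le),
    show ((j : ℝ) + 1) * Real.log 2 - j * Real.log 2 = Real.log 2 by ring, f₂_log_two_left]
  ring

theorem IsMinValue.le_block {x y z : ℝ} (h : IsMinValue x y z) {k : ℕ}
    (hx : x ∈ Icc (k * Real.log 2) ((k + 1) * Real.log 2))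
    (hy : y ∈ Icc (k * Real.log 2) ((k + 1) * Real.log 2)) :
    z ≤ f₂ (x - k * Real.log 2) (y - k * Real.log 2) + k * Real.log 2 := by
  rcases h with rfl | ⟨j, hxj, hyj, rfl⟩
  · have h1 := le_f₂_left (sub_mul_log_two_mem_Icc hx) (sub_mul_log_two_mem_Icc hy)
    have h2 := le_f₂_right (sub_mul_log_two_mem_Icc hx) (sub_mul_log_two_mem_Icc hy)
    exact max_le (by linarith) (by linarith)
  · rcases lt_trichotomy j k with h | rfl | h
    · exact (f₂_block_eq_of_lt h hxj hyj hx hy).le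
    · exact le_rfl
    · exact (f₂_block_eq_of_lt h hx hy hxj hyj).ge

theorem theorem4p1 (n : ℕ) (x y : ℝ)
    (hx : x ∈ Set.Icc 0 (n * Real.log 2)) (hy : y ∈ Set.Icc 0 (n * Real.log 2)) :
    -- the minimum defining `f_{ℤ/2ⁿ}(x, y)` is attained
    IsLeast (sumEntropies.{u} (ZMod (2 ^ n)) x y) (minSumEntropy.{u} (ZMod (2 ^ n)) x y) ∧
    (∀ k : ℕ,
      x ∈ Set.Icc (k * Real.log 2) ((k + 1) * Real.log 2) →
      y ∈ Set.Icc (k * Real.log 2) ((k + 1) * Real.log 2) →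
      minSumEntropy.{u} (ZMod (2 ^ n)) x y =
        f₂ (x - k * Real.log 2) (y - k * Real.log 2) + k * Real.log 2) ∧
    ((¬ ∃ k : ℕ,
        x ∈ Set.Icc (k * Real.log 2) ((k + 1) * Real.log 2) ∧
        y ∈ Set.Icc (k * Real.log 2) ((k + 1) * Real.log 2)) →
      minSumEntropy.{u} (ZMod (2 ^ n)) x y = max x y) := by
  obtain ⟨p, q, hp, hq, hpx, hqy, hmin⟩ := exists_isMinValue_weightEntropy n hx hy
  have hbelow : ∀ z ∈ sumEntropies.{u} (ZMod (2 ^ n)) x y, IsAboveMin x y z := by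
    intro z hz
    obtain ⟨p', q', hp', hq', rfl, rfl, rfl⟩ := mem_sumEntropies_iff.1 hz
    exact isAboveMin_weightEntropy n hp' hq'
  have hmem : weightEntropy (addConv p q) ∈ sumEntropies.{u} (ZMod (2 ^ n)) x y :=
    mem_sumEntropies_iff.2 ⟨p, q, hp, hq, hpx, hqy, rfl⟩
  have hleast : IsLeast (sumEntropies.{u} (ZMod (2 ^ n)) x y) (weightEntropy (addConv p q)) :=
    ⟨hmem, fun z hz => hmin.le (hbelow z hz)⟩
  have heq : minSumEntropy.{u} (ZMod (2 ^ n)) x y = weightEntropy (addConv p q) :=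
    hleast.csInf_eq
  rw [heq]
  refine ⟨hleast, fun k hxk hyk => le_antisymm (hmin.le_block hxk hyk)
    ((hbelow _ hmem).2 k hxk hyk), fun hno => ?_⟩
  rcases hmin with h | ⟨k, hxk, hyk, -⟩
  · exact h
  · exact absurd ⟨k, hxk, hyk⟩ hno
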